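/- Let $n\in\mathbb N$ and let $J\in M_n(\mathbb C)$ be a constant matrix with $J\neq 0$ and $J^*=-J$. Let $H,W:\mathbb R\to M_n(\mathbb C)$ have Lebesgue measurable entries, with $W(t)^*=W(t)\ge 0$ and $\det W(t)\ne 0$ for a.e. $t\in\mathbb R$. Suppose that for some $d>0$ we have $H(t+d)=H(t)$ and $W(t+d)=W(t)$ for all $t\in\mathbb R$, and that $H(t)^*=H(t)$ for a.e. $t\in(0,d)$. *Operators.* Functions are identified when equal a.e., and $\langle x,y\rangle=x^*y$ on $\mathbb C^n$. Let $L^2(\mathbb R;W)$ be the Hilbert space of measurable $f:\mathbb R\to\mathbb C^n$ with $\int_{\mathbb R}\langle W(t)f(t),f(t)\rangle\,dt<\infty$, with inner product $\langle f,g\rangle_W=\int_{\mathbb R}\langle W(t)f(t),g(t)\rangle\,dt$. For measurable $f$ such that $Jf$ is (a.e. equal to) a function that is absolutely continuous on every compact interval, put $\mathcal Lf=W^{-1}\left(\frac{d}{dt}(Jf)+Hf\right)$; such $f$ form $D(\mathcal L)$. The maximal operator is $Lf=\mathcal Lf$ on $D(L)=\{f\in L^2(\mathbb R;W): f\in D(\mathcal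 L),\ \mathcal Lf\in L^2(\mathbb R;W)\}$, and the minimal operator $L_0'$ is the restriction of $L$ to $D(L_0')=\{f\in D(L): Jf\text{ has compact support}\}$. *Local index-1 hypotheses.* For a measurable $K:\mathbb R\to M_n(\mathbb C)$, the local index-1 hypotheses for $K,W$ with respect to $J$ on $\mathbb R$ are the following. If $\det J\ne0$: all entries of $K$ and $W$ are in $L^1_{loc}(\mathbb R)$. If $\det J=0$: let $n_1=\operatorname{rank}J$, $n_2=n-n_1$, let $V$ be a unitary matrix with $V^{-1}JV=\begin{bmatrix}J_{11}&0\\0&0\end{bmatrix}$, where $J_{11}\in M_{n_1}(\mathbb C)$ is invertible, and let $K_{ij},W_{ij}$ $(i,j=1,2)$ be the blocks, of size $n_i\times n_j$, of $V^{-1}KV$ and $V^{-1}WV$; then $K_{22}(t)$ is invertible for a.e. $t$ (with $K_{22}^{-1}$ measurable) and, entrywise, $$K_{12}K_{22}^{-1}W_{22}^{1/2}\in L^2_{loc}(\mathbb R),\qquad K_{11}-K_{12}K_{22}^{-1}K_{21}\in L^1_{loc}(\mathbb R),\qquad W_{11}\in L^1_{loc}(\mathbb R),$$ $$W_{22}^{1/2}K_{22}^{-1}W_{22}^{1/2}\in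 L^\infty_{loc}(\mathbb R),\qquad W_{22}^{1/2}\left(W_{22}^{-1}W_{21}-K_{22}^{-1}K_{21}\right)\in L^2_{loc}(\mathbb R),\qquad W_{11}-W_{12}W_{22}^{-1}W_{21}\in L^1_{loc}(\mathbb R).$$ (These conditions do not depend on the choice of $V$.) **Theorem.** Suppose that the local index-1 hypotheses hold for $K=H-z_0W$ and $W$ with respect to $J$ on $\mathbb R$ for some $z_0\in\mathbb C\setminus\mathbb R$. Then: 1. $D(L_0')$ is dense in $L^2(\mathbb R;W)$, and $(L_0')^*=L$. 2. $L$ is a self-adjoint operator on $L^2(\mathbb R;W)$. 3. $L_0'$ is essentially self-adjoint with closure $L$: it is closable, its closure is self-adjoint, and $\overline{L_0'}=L$. 4. $L$ has no eigenvalues of finite multiplicity: for every $z\in\mathbb C$, $\ker(L-zI)$ is either $\{0\}$ or infinite-dimensional. -/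

import Mathlib

open MeasureTheory Matrix
open scoped MatrixOrder ComplexOrder LinearPMap

noncomputable section

namespace DAE

/-! ### Measurable coefficients and local Lebesgue spaces of matrix functions -/

/-- The entries of the matrix function `A` are Lebesgue measurable on `ℝ`. -/
def MeasMat {m k : Type*} (A : ℝ → Matrix m k ℂ) : Prop :=
  ∀ i j, AEMeasurable (fun t => A t i j) volume

/-- The entries of the matrix function `A` belong to `L^p_loc(ℝ)`. -/
def MemLpLoc {m k : Type*} (p : ENNReal) (A : ℝ → Matrix m k ℂ) : Prop :=
  ∀ i j, ∀ a b : ℝ, MemLp (fun t => A t i j) p (volume.restrict (Set.Icc a b))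

/-- `W` is a measurable matrix weight: `W(t)* = W(t) ≥ 0` and `det W(t) ≠ 0` for a.e. `t`. -/
structure IsWeight {n : ℕ} (W : ℝ → Matrix (Fin n) (Fin n) ℂ) : Prop where
  meas : MeasMat W
  posSemidef : ∀ᵐ t, (W t).PosSemidef
  det_ne_zero : ∀ᵐ t, (W t).det ≠ 0

/-! ### The local index-1 hypotheses -/

/-- The unitary matrix `V` brings `J` to the block form `diag(J₁₁, 0)` with `J₁₁` invertible.
The two index blocks have sizes `n₁` and `n₂`; necessarily `n₁ = rank J` and `n₁ + n₂ = n`. -/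
structure IsAdapted {n n₁ n₂ : ℕ} (J : Matrix (Fin n) (Fin n) ℂ)
    (V : Matrix (Fin n) (Fin n₁ ⊕ Fin n₂) ℂ) : Prop where
  conjTranspose_mul_self : Vᴴ * V = 1
  mul_conjTranspose_self : V * Vᴴ = 1
  block_form : ∃ J₁₁ : Matrix (Fin n₁) (Fin n₁) ℂ,
    J₁₁.det ≠ 0 ∧ Vᴴ * J * V = Matrix.fromBlocks J₁₁ 0 0 0

/-- The conditions of the local index-1 hypotheses in the case `det J = 0`, in terms of the blocks
`Hᵢⱼ` and `Wᵢⱼ` of `V⁻¹HV` and `V⁻¹WV`. -/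
structure BlockIndexOne {n₁ n₂ : ℕ}
    (H₁₁ W₁₁ : ℝ → Matrix (Fin n₁) (Fin n₁) ℂ) (H₁₂ W₁₂ : ℝ → Matrix (Fin n₁) (Fin n₂) ℂ)
    (H₂₁ W₂₁ : ℝ → Matrix (Fin n₂) (Fin n₁) ℂ) (H₂₂ W₂₂ : ℝ → Matrix (Fin n₂) (Fin n₂) ℂ) :
    Prop where
  det_H₂₂ : ∀ᵐ t, (H₂₂ t).det ≠ 0
  meas_inv_H₂₂ : MeasMat fun t => (H₂₂ t)⁻¹
  memL2_left : MemLpLoc 2 fun t => H₁₂ t * (H₂₂ t)⁻¹ * CFC.sqrt (W₂₂ t)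
  schur_H : MemLpLoc 1 fun t => H₁₁ t - H₁₂ t * (H₂₂ t)⁻¹ * H₂₁ t
  memL1_W₁₁ : MemLpLoc 1 W₁₁
  memLtop : MemLpLoc ⊤ fun t => CFC.sqrt (W₂₂ t) * (H₂₂ t)⁻¹ * CFC.sqrt (W₂₂ t)
  memL2_right : MemLpLoc 2 fun t =>
    CFC.sqrt (W₂₂ t) * ((W₂₂ t)⁻¹ * W₂₁ t - (H₂₂ t)⁻¹ * H₂₁ t)
  schur_W : MemLpLoc 1 fun t => W₁₁ t - W₁₂ t * (W₂₂ t)⁻¹ * W₂₁ t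

/-- The local index-1 hypotheses for `H, W` with respect to `J` on the interval `ℝ`. -/
def LocalIndexOne {n : ℕ} (J : Matrix (Fin n) (Fin n) ℂ)
    (H W : ℝ → Matrix (Fin n) (Fin n) ℂ) : Prop :=
  (J.det ≠ 0 → MemLpLoc 1 H ∧ MemLpLoc 1 W) ∧
  (J.det = 0 → ∃ (n₁ n₂ : ℕ) (V : Matrix (Fin n) (Fin n₁ ⊕ Fin n₂) ℂ), IsAdapted J V ∧
    BlockIndexOne
      (fun t => (Vᴴ * H t * V).toBlocks₁₁) (fun t => (Vᴴ * W t * V).toBlocks₁₁)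
      (fun t => (Vᴴ * H t * V).toBlocks₁₂) (fun t => (Vᴴ * W t * V).toBlocks₁₂)
      (fun t => (Vᴴ * H t * V).toBlocks₂₁) (fun t => (Vᴴ * W t * V).toBlocks₂₁)
      (fun t => (Vᴴ * H t * V).toBlocks₂₂) (fun t => (Vᴴ * W t * V).toBlocks₂₂))

/-! ### Lebesgue measurable vector functions -/

/-- `[𝓜(ℝ)]ⁿ`: Lebesgue measurable functions `ℝ → ℂⁿ` up to equality almost everywhere. -/
abbrev MeasFun (n : ℕ) : Type := ℝ →ₘ[volume] (Fin n → ℂ)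

lemma aesm_pi_iff {n : ℕ} {f : ℝ → Fin n → ℂ} :
    AEStronglyMeasurable f volume ↔ ∀ i, AEMeasurable (fun t => f t i) volume := by
  rw [aestronglyMeasurable_iff_aemeasurable, aemeasurable_pi_iff]

lemma MeasMat.mulVec {n : ℕ} {A : ℝ → Matrix (Fin n) (Fin n) ℂ} (hA : MeasMat A)
    {f : ℝ → Fin n → ℂ} (hf : AEStronglyMeasurable f volume) :
    AEStronglyMeasurable (fun t => A t *ᵥ f t) volume := by
  rw [aesm_pi_iff] at hf ⊢
  intro i
  simp only [Matrix.mulVec, dotProduct]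
  exact Finset.aemeasurable_fun_sum _ fun j _ => (hA i j).mul (hf j)

lemma MeasMat.inv {n : ℕ} {A : ℝ → Matrix (Fin n) (Fin n) ℂ} (hA : MeasMat A) :
    MeasMat fun t => (A t)⁻¹ := by
  have h : ∀ (B : ℝ → Matrix (Fin n) (Fin n) ℂ), MeasMat B →
      AEMeasurable (fun t => (B t).det) volume := by
    intro B hB
    simp only [Matrix.det_apply']
    exact Finset.aemeasurable_fun_sum _ fun σ _ =>
      (Finset.aemeasurable_fun_prod _ fun j _ => hB _ _).const_mul _
  intro i j
  simp only [Matrix.inv_def, Matrix.smul_apply, smul_eq_mul, Matrix.adjugate_apply,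
    Ring.inverse_eq_inv']
  refine (h A hA).inv.mul (h _ ?_)
  intro k l
  by_cases hk : k = j
  · subst hk; simp
  · simpa [Matrix.updateRow_ne hk] using hA k l

lemma MeasMat.sqrt {n : ℕ} {A : ℝ → Matrix (Fin n) (Fin n) ℂ} (hA : MeasMat A)
    (hpos : ∀ᵐ t, (A t).PosSemidef) : MeasMat fun t => CFC.sqrt (A t) := by
  classical
  let S : Set (Fin n → Fin n → ℂ) := {B | (0 : Matrix (Fin n) (Fin n) ℂ) ≤ Matrix.of B}
  let F : (Fin n → Fin n → ℂ) → (Fin n → Fin n → ℂ) :=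
    fun B => (CFC.sqrt (Matrix.of B) : Matrix (Fin n) (Fin n) ℂ)
  have hF : ContinuousOn F S := by
    open scoped Matrix.Norms.L2Operator in
    exact CFC.continuousOn_sqrt (A := Matrix (Fin n) (Fin n) ℂ)
  have hS : IsClosed S := by
    have : S = {B | ∀ x y : Fin n, (starRingEnd ℂ) (B y x) = B x y} ∩
        {B | ∀ x : Fin n → ℂ, 0 ≤ star x ⬝ᵥ (Matrix.of B *ᵥ x)} := by
      ext B
      simp only [S, Set.mem_ofPred_eq, Set.mem_inter_iff, Matrix.nonneg_iff_posSemidef,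
        Matrix.posSemidef_iff_dotProduct_mulVec]
      refine and_congr ?_ Iff.rfl
      exact ⟨fun h x y => h.apply x y, fun h => Matrix.IsHermitian.ext fun i j => h i j⟩
    rw [this]
    refine IsClosed.inter ?_ ?_
    · simp only [Set.ofPred_forall]
      exact isClosed_iInter fun x => isClosed_iInter fun y =>
        isClosed_eq (by fun_prop) (by fun_prop)
    · simp only [Set.ofPred_forall]
      refine isClosed_iInter fun x => isClosed_le continuous_const ?_
      simp only [Matrix.mulVec, dotProduct, Matrix.of_apply]
      fun_prop
  have hG : Measurable (S.piecewise F 0) :=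
    ContinuousOn.measurable_piecewise hF continuousOn_const hS.measurableSet
  let A' : ℝ → Fin n → Fin n → ℂ := fun t i j => A t i j
  have hA' : AEMeasurable A' volume :=
    aemeasurable_pi_iff.2 fun i => aemeasurable_pi_iff.2 fun j => hA i j
  have h1 : AEMeasurable (fun t => S.piecewise F 0 (A' t)) volume := hG.comp_aemeasurable hA'
  intro i j
  have h2 := aemeasurable_pi_iff.1 (aemeasurable_pi_iff.1 h1 i) j
  refine h2.congr ?_
  filter_upwards [hpos] with t ht
  have : A' t ∈ S := ht.nonneg
  rw [Set.piecewise_eq_of_mem _ _ _ this]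
  rfl

/-! ### The weighted Hilbert space -/

section WeightedL2

variable {n : ℕ} {W : ℝ → Matrix (Fin n) (Fin n) ℂ}

/-- The pointwise square root `W^{1/2} f`, as a function with values in Euclidean space. -/
def sqrtMul (W : ℝ → Matrix (Fin n) (Fin n) ℂ) (f : ℝ → Fin n → ℂ) (t : ℝ) :
    EuclideanSpace ℂ (Fin n) := WithLp.toLp 2 (CFC.sqrt (W t) *ᵥ f t)

lemma sqrtMul_inner (hW : IsWeight W) : ∀ᵐ t, ∀ f g : ℝ → Fin n → ℂ,
    inner ℂ (sqrtMul W f t) (sqrtMul W g t) = star (W t *ᵥ f t) ⬝ᵥ g t := by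
  filter_upwards [hW.posSemidef] with t ht f g
  have h1 : CFC.sqrt (W t) * CFC.sqrt (W t) = W t :=
    CFC.sqrt_mul_sqrt_self _ ht.nonneg
  have h2 : (CFC.sqrt (W t))ᴴ = CFC.sqrt (W t) :=
    (CFC.sqrt_nonneg (W t)).posSemidef.1
  rw [sqrtMul, sqrtMul, EuclideanSpace.inner_toLp_toLp, dotProduct_comm, Matrix.star_mulVec,
    h2, Matrix.dotProduct_mulVec, Matrix.vecMul_vecMul, h1, Matrix.star_mulVec, ht.1.eq]

lemma sqrtMul_meas (hW : IsWeight W) {f : ℝ → Fin n → ℂ} (hf : AEStronglyMeasurable f volume) :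
    AEStronglyMeasurable (sqrtMul W f) volume :=
  (PiLp.continuous_toLp 2 _).comp_aestronglyMeasurable
    ((hW.meas.sqrt hW.posSemidef).mulVec hf)

lemma sqrtMul_memLp_iff (hW : IsWeight W) {f : ℝ → Fin n → ℂ}
    (hf : AEStronglyMeasurable f volume) :
    MemLp (sqrtMul W f) 2 volume ↔
      Integrable (fun t => star (W t *ᵥ f t) ⬝ᵥ f t) volume := by
  rw [memLp_two_iff_integrable_sq_norm (sqrtMul_meas hW hf)]
  have h : (fun t => star (W t *ᵥ f t) ⬝ᵥ f t) =ᵐ[volume]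
      fun t => ((‖sqrtMul W f t‖ ^ 2 : ℝ) : ℂ) := by
    filter_upwards [sqrtMul_inner hW] with t ht
    rw [← ht f f, inner_self_eq_norm_sq_to_K]
    push_cast; rfl
  rw [integrable_congr h]
  exact ⟨fun h => h.ofReal, fun h => by
    have h' := h.re
    simp only [RCLike.re_eq_complex_re, Complex.ofReal_re] at h'
    exact h'⟩

lemma sqrtMul_congr {f g : ℝ → Fin n → ℂ} (h : f =ᵐ[volume] g) :
    sqrtMul W f =ᵐ[volume] sqrtMul W g := by
  filter_upwards [h] with t ht; simp [sqrtMul, ht]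

lemma sqrtMul_add (f g : ℝ → Fin n → ℂ) : sqrtMul W (f + g) = sqrtMul W f + sqrtMul W g := by
  ext t : 1; simp [sqrtMul, Matrix.mulVec_add]

lemma sqrtMul_smul (c : ℂ) (f : ℝ → Fin n → ℂ) : sqrtMul W (c • f) = c • sqrtMul W f := by
  ext t : 1; simp [sqrtMul, Matrix.mulVec_smul]

/-- `L²(ℝ; W)` as a subspace of `[𝓜(ℝ)]ⁿ`: the functions with `∫ ⟨W(t)f(t), f(t)⟩ dt < ∞`,
where `⟨x, y⟩ = x*y`. -/
def weightedL2 (hW : IsWeight W) : Submodule ℂ (MeasFun n) where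
  carrier := {f | Integrable (fun t => star (W t *ᵥ f t) ⬝ᵥ f t) volume}
  zero_mem' := by
    rw [Set.mem_ofPred_eq, ← sqrtMul_memLp_iff hW (AEEqFun.aestronglyMeasurable _)]
    refine (MemLp.zero (p := 2) (μ := volume) (ε := EuclideanSpace ℂ (Fin n))).ae_eq ?_
    filter_upwards [AEEqFun.coeFn_zero (α := ℝ) (μ := volume) (β := Fin n → ℂ)] with t ht
    simp [sqrtMul, ht]
  add_mem' {f g} hf hg := by
    rw [Set.mem_ofPred_eq, ← sqrtMul_memLp_iff hW (AEEqFun.aestronglyMeasurable _)] at *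
    refine (hf.add hg).ae_eq ?_
    rw [← sqrtMul_add]
    exact sqrtMul_congr (AEEqFun.coeFn_add f g).symm
  smul_mem' c f hf := by
    rw [Set.mem_ofPred_eq, ← sqrtMul_memLp_iff hW (AEEqFun.aestronglyMeasurable _)] at *
    refine (hf.const_smul c).ae_eq ?_
    rw [← sqrtMul_smul]
    exact sqrtMul_congr (AEEqFun.coeFn_smul c f).symm

/-- The Hilbert space `L²(ℝ; W)`. -/
def WeightedL2 (hW : IsWeight W) : Type := weightedL2 hW

namespace WeightedL2

variable {hW : IsWeight W}

instance : AddCommGroup (WeightedL2 hW) := inferInstanceAs (AddCommGroup (weightedL2 hW))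

instance : Module ℂ (WeightedL2 hW) := inferInstanceAs (Module ℂ (weightedL2 hW))

variable (hW) in
/-- The inclusion of `L²(ℝ; W)` into `[𝓜(ℝ)]ⁿ`. -/
def incl : WeightedL2 hW →ₗ[ℂ] MeasFun n := (weightedL2 hW).subtype

lemma incl_injective : Function.Injective (incl hW) := Subtype.val_injective

lemma incl_mem (f : WeightedL2 hW) : incl hW f ∈ weightedL2 hW := f.2

/-- An element of `[𝓜(ℝ)]ⁿ` with finite weighted norm, as an element of `L²(ℝ; W)`. -/
def of (f : MeasFun n) (hf : f ∈ weightedL2 hW) : WeightedL2 hW := ⟨f, hf⟩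

@[simp] lemma incl_of (f : MeasFun n) (hf : f ∈ weightedL2 hW) : incl hW (of f hf) = f := rfl

/-- The inner product `⟨f, g⟩_W = ∫ ⟨W(t)f(t), g(t)⟩ dt`, where `⟨x, y⟩ = x*y`. -/
instance : Inner ℂ (WeightedL2 hW) where
  inner f g := ∫ t, star (W t *ᵥ incl hW f t) ⬝ᵥ incl hW g t

lemma inner_def (f g : WeightedL2 hW) :
    inner ℂ f g = ∫ t, star (W t *ᵥ incl hW f t) ⬝ᵥ incl hW g t := rfl

lemma memLp (f : WeightedL2 hW) : MemLp (sqrtMul W (incl hW f)) 2 volume :=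
  (sqrtMul_memLp_iff hW (AEEqFun.aestronglyMeasurable _)).2 f.2

/-- Multiplication by `W^{1/2}`, from `L²(ℝ; W)` to `[L²(ℝ)]ⁿ`. -/
def toL2 : WeightedL2 hW →ₗ[ℂ] Lp (EuclideanSpace ℂ (Fin n)) 2 (volume : Measure ℝ) where
  toFun f := (memLp f).toLp _
  map_add' f g := by
    rw [← MemLp.toLp_add, MemLp.toLp_eq_toLp_iff, ← sqrtMul_add, map_add]
    exact sqrtMul_congr (AEEqFun.coeFn_add _ _)
  map_smul' c f := by
    rw [RingHom.id_apply, ← MemLp.toLp_const_smul, MemLp.toLp_eq_toLp_iff, ← sqrtMul_smul,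
      map_smul]
    exact sqrtMul_congr (AEEqFun.coeFn_smul _ _)

lemma coeFn_toL2 (f : WeightedL2 hW) : toL2 f =ᵐ[volume] sqrtMul W (incl hW f) :=
  (memLp f).coeFn_toLp

lemma inner_toL2 (f g : WeightedL2 hW) : inner ℂ (toL2 f) (toL2 g) = inner ℂ f g := by
  rw [MeasureTheory.L2.inner_def, inner_def]
  refine integral_congr_ae ?_
  filter_upwards [coeFn_toL2 f, coeFn_toL2 g, sqrtMul_inner hW] with t h1 h2 h3
  rw [h1, h2, h3]

lemma sqrt_det_ne_zero (hW : IsWeight W) : ∀ᵐ t, IsUnit (CFC.sqrt (W t)).det := by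
  filter_upwards [hW.posSemidef, hW.det_ne_zero] with t h1 h2
  have h : CFC.sqrt (W t) * CFC.sqrt (W t) = W t := CFC.sqrt_mul_sqrt_self _ h1.nonneg
  rw [isUnit_iff_ne_zero]
  intro h0
  apply h2
  rw [← h, Matrix.det_mul, h0, zero_mul]

lemma toL2_bijective : Function.Bijective (toL2 (hW := hW)) := by
  constructor
  · intro f g h
    apply incl_injective
    refine AEEqFun.ext ?_
    filter_upwards [(MemLp.toLp_eq_toLp_iff (memLp f) (memLp g)).1 h, sqrt_det_ne_zero hW]
      with t h1 h2
    have h3 : CFC.sqrt (W t) *ᵥ incl hW f t = CFC.sqrt (W t) *ᵥ incl hW g t :=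
      (WithLp.toLp_injective 2) h1
    exact Matrix.mulVec_injective_of_isUnit ((Matrix.isUnit_iff_isUnit_det _).2 h2) h3
  · intro h
    have hm : AEStronglyMeasurable (fun t => (CFC.sqrt (W t))⁻¹ *ᵥ (h t).ofLp) volume :=
      ((hW.meas.sqrt hW.posSemidef).inv).mulVec
        ((PiLp.continuous_ofLp 2 _).comp_aestronglyMeasurable (Lp.aestronglyMeasurable h))
    have hs : sqrtMul W (AEEqFun.mk _ hm) =ᵐ[volume] h := by
      filter_upwards [AEEqFun.coeFn_mk _ hm, sqrt_det_ne_zero hW] with t h1 h2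
      rw [sqrtMul, h1, Matrix.mulVec_mulVec, Matrix.mul_nonsing_inv _ h2, Matrix.one_mulVec]
    have hmem : AEEqFun.mk _ hm ∈ weightedL2 hW :=
      (sqrtMul_memLp_iff hW (AEEqFun.aestronglyMeasurable _)).1 ((Lp.memLp h).ae_eq hs.symm)
    exact ⟨of _ hmem, Lp.ext ((coeFn_toL2 _).trans hs)⟩

/-- The inner product of `L²(ℝ; W)` is a positive definite Hermitian form. -/
abbrev core : InnerProductSpace.Core ℂ (WeightedL2 hW) where
  conj_inner_symm f g := by
    rw [← inner_toL2, ← inner_toL2]; exact inner_conj_symm _ _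
  re_inner_nonneg f := by rw [← inner_toL2]; exact inner_self_nonneg
  add_left f g h := by simp only [← inner_toL2, map_add]; exact inner_add_left _ _ _
  smul_left f g c := by simp only [← inner_toL2, map_smul]; exact inner_smul_left _ _ _
  definite f h := by
    rw [← inner_toL2] at h
    exact toL2_bijective.1 ((inner_self_eq_zero.1 h).trans (map_zero _).symm)

instance : NormedAddCommGroup (WeightedL2 hW) :=
  core.toNormedAddCommGroup

instance : InnerProductSpace ℂ (WeightedL2 hW) :=
  InnerProductSpace.ofCore core.toCore

instance : CompleteSpace (WeightedL2 hW) := by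
  have hiso : Isometry (toL2 (hW := hW)) := AddMonoidHomClass.isometry_of_norm _ fun f => by
    rw [@norm_eq_sqrt_re_inner ℂ _ _ _ _ (toL2 f), @norm_eq_sqrt_re_inner ℂ _ _ _ _ f, inner_toL2]
  refine (completeSpace_congr (e := Equiv.ofBijective _ toL2_bijective) ?_).2 inferInstance
  exact hiso.isUniformEmbedding

end WeightedL2

end WeightedL2

/-! ### The differential-algebraic operator -/

section Operators

variable {n : ℕ}

/-- `AC_loc(ℝ)ⁿ = W^{1,1}_loc(ℝ)ⁿ`: absolutely continuous on every compact interval. -/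
def IsLocAC (u : ℝ → Fin n → ℂ) : Prop := ∀ a b : ℝ, AbsolutelyContinuousOnInterval u a b

lemma IsLocAC.zero : IsLocAC (0 : ℝ → Fin n → ℂ) := fun _ _ =>
  (LipschitzWith.const (0 : Fin n → ℂ)).lipschitzOnWith.absolutelyContinuousOnInterval

lemma IsLocAC.add {u v : ℝ → Fin n → ℂ} (hu : IsLocAC u) (hv : IsLocAC v) : IsLocAC (u + v) :=
  fun a b => (hu a b).add (hv a b)

lemma IsLocAC.const_smul {u : ℝ → Fin n → ℂ} (c : ℂ) (hu : IsLocAC u) : IsLocAC (c • u) :=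
  fun a b => (hu a b).const_smul c

lemma IsLocAC.continuous {u : ℝ → Fin n → ℂ} (hu : IsLocAC u) : Continuous u := by
  rw [continuous_iff_continuousAt]
  intro x
  refine (hu (x - 1) (x + 1)).continuousOn.continuousAt ?_
  rw [Set.uIcc_of_le (by linarith)]
  exact Icc_mem_nhds (by linarith) (by linarith)

lemma IsLocAC.ae_differentiableAt {u : ℝ → Fin n → ℂ} (hu : IsLocAC u) :
    ∀ᵐ t, DifferentiableAt ℝ u t := by
  refine LocallyBoundedVariationOn.ae_differentiableAt ?_
  intro a b _ _
  rw [Set.univ_inter]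
  exact (hu a b).boundedVariationOn.mono Set.Icc_subset_uIcc

/-- `u` is the locally absolutely continuous representative of `Jf`. -/
def IsACRep (J : Matrix (Fin n) (Fin n) ℂ) (f : MeasFun n) (u : ℝ → Fin n → ℂ) : Prop :=
  IsLocAC u ∧ u =ᵐ[volume] fun t => J *ᵥ f t

variable {J : Matrix (Fin n) (Fin n) ℂ}

lemma IsACRep.zero : IsACRep J 0 0 := by
  refine ⟨IsLocAC.zero, ?_⟩
  filter_upwards [AEEqFun.coeFn_zero (α := ℝ) (μ := volume) (β := Fin n → ℂ)] with t ht
  simp [ht]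

lemma IsACRep.add {f g : MeasFun n} {u v : ℝ → Fin n → ℂ} (hu : IsACRep J f u)
    (hv : IsACRep J g v) : IsACRep J (f + g) (u + v) := by
  refine ⟨hu.1.add hv.1, ?_⟩
  filter_upwards [AEEqFun.coeFn_add f g, hu.2, hv.2] with t h1 h2 h3
  simp [h1, h2, h3, Matrix.mulVec_add]

lemma IsACRep.const_smul {f : MeasFun n} {u : ℝ → Fin n → ℂ} (c : ℂ) (hu : IsACRep J f u) :
    IsACRep J (c • f) (c • u) := by
  refine ⟨hu.1.const_smul c, ?_⟩
  filter_upwards [AEEqFun.coeFn_smul c f, hu.2] with t h1 h2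
  simp [h1, h2, Matrix.mulVec_smul]

lemma IsACRep.unique {f : MeasFun n} {u v : ℝ → Fin n → ℂ} (hu : IsACRep J f u)
    (hv : IsACRep J f v) : u = v :=
  (Continuous.ae_eq_iff_eq volume hu.1.continuous hv.1.continuous).1 (hu.2.trans hv.2.symm)

variable {H W : ℝ → Matrix (Fin n) (Fin n) ℂ}

lemma daOp_meas (hH : MeasMat H) (hW : IsWeight W) (f : MeasFun n) (u : ℝ → Fin n → ℂ) :
    AEStronglyMeasurable (fun t => (W t)⁻¹ *ᵥ (deriv u t + H t *ᵥ f t)) volume :=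
  hW.meas.inv.mulVec ((aestronglyMeasurable_deriv u volume).add
    (hH.mulVec (AEEqFun.aestronglyMeasurable f)))

/-- The differential-algebraic operator `𝓛 f = W⁻¹ (d/dt (Jf) + Hf)`, on the domain of all `f` in
`[𝓜(ℝ)]ⁿ` with `Jf` in `[W^{1,1}_loc(ℝ)]ⁿ`. -/
def daOp (J : Matrix (Fin n) (Fin n) ℂ) (hH : MeasMat H) (hW : IsWeight W) :
    MeasFun n →ₗ.[ℂ] MeasFun n where
  domain :=
    { carrier := {f | ∃ u, IsACRep J f u}
      zero_mem' := ⟨0, IsACRep.zero⟩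
      add_mem' := fun ⟨u, hu⟩ ⟨v, hv⟩ => ⟨u + v, hu.add hv⟩
      smul_mem' := fun c _ ⟨u, hu⟩ => ⟨c • u, hu.const_smul c⟩ }
  toFun :=
    { toFun := fun f => AEEqFun.mk _ (daOp_meas hH hW f.1 f.2.choose)
      map_add' := fun f g => by
        have hf := f.2.choose_spec
        have hg := g.2.choose_spec
        have h := (f + g).2.choose_spec
        have heq := IsACRep.unique h (hf.add hg)
        refine AEEqFun.ext ?_
        filter_upwards [AEEqFun.coeFn_mk _ (daOp_meas hH hW f.1 f.2.choose),
          AEEqFun.coeFn_mk _ (daOp_meas hH hW g.1 g.2.choose),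
          AEEqFun.coeFn_mk _ (daOp_meas hH hW (f + g).1 (f + g).2.choose),
          AEEqFun.coeFn_add (AEEqFun.mk _ (daOp_meas hH hW f.1 f.2.choose))
            (AEEqFun.mk _ (daOp_meas hH hW g.1 g.2.choose)),
          AEEqFun.coeFn_add f.1 g.1, hf.1.ae_differentiableAt, hg.1.ae_differentiableAt]
          with t h1 h2 h3 h4 h5 h6 h7
        rw [h4, h3, Pi.add_apply, h1, h2, heq, deriv_add h6 h7, Submodule.coe_add, h5,
          Pi.add_apply, ← Matrix.mulVec_add (W t)⁻¹,
          Matrix.mulVec_add (H t), add_add_add_comm]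
      map_smul' := fun c f => by
        have hf := f.2.choose_spec
        have h := (c • f).2.choose_spec
        have heq := IsACRep.unique h (hf.const_smul c)
        refine AEEqFun.ext ?_
        filter_upwards [AEEqFun.coeFn_mk _ (daOp_meas hH hW f.1 f.2.choose),
          AEEqFun.coeFn_mk _ (daOp_meas hH hW (c • f).1 (c • f).2.choose),
          AEEqFun.coeFn_smul c (AEEqFun.mk _ (daOp_meas hH hW f.1 f.2.choose)),
          AEEqFun.coeFn_smul c f.1, hf.1.ae_differentiableAt]
          with t h1 h3 h4 h5 h6
        rw [RingHom.id_apply, h4, h3, Pi.smul_apply, h1, heq, deriv_const_smul c h6,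
          Submodule.coe_smul, h5, Pi.smul_apply, Matrix.mulVec_smul, ← smul_add,
          Matrix.mulVec_smul] }

lemma mem_daOp_domain {hH : MeasMat H} {hW : IsWeight W} {f : MeasFun n} :
    f ∈ (daOp J hH hW).domain ↔ ∃ u, IsACRep J f u := Iff.rfl

lemma daOp_apply {hH : MeasMat H} {hW : IsWeight W} (f : (daOp J hH hW).domain)
    {u : ℝ → Fin n → ℂ} (hu : IsACRep J f.1 u) :
    daOp J hH hW f =ᵐ[volume] fun t => (W t)⁻¹ *ᵥ (deriv u t + H t *ᵥ f.1 t) := by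
  have h := IsACRep.unique hu f.2.choose_spec
  rw [h]
  exact AEEqFun.coeFn_mk _ (daOp_meas hH hW f.1 f.2.choose)

/-- `D(L) = {f ∈ L²(ℝ; W) : f ∈ D(𝓛), 𝓛f ∈ L²(ℝ; W)}`. -/
def maximalDomain (J : Matrix (Fin n) (Fin n) ℂ) (hH : MeasMat H) (hW : IsWeight W) :
    Submodule ℂ (WeightedL2 hW) where
  carrier := {f | ∃ h : WeightedL2.incl hW f ∈ (daOp J hH hW).domain,
    daOp J hH hW ⟨WeightedL2.incl hW f, h⟩ ∈ weightedL2 hW}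
  zero_mem' := by
    have h0 : WeightedL2.incl hW 0 ∈ (daOp J hH hW).domain := by
      rw [map_zero]; exact zero_mem _
    refine ⟨h0, ?_⟩
    have : (⟨WeightedL2.incl hW 0, h0⟩ : (daOp J hH hW).domain) = 0 :=
      Subtype.ext (map_zero _)
    rw [this, LinearPMap.map_zero]
    exact zero_mem _
  add_mem' := fun {f g} ⟨hf, hf'⟩ ⟨hg, hg'⟩ => by
    have h : WeightedL2.incl hW (f + g) ∈ (daOp J hH hW).domain := by
      rw [map_add]; exact add_mem hf hg
    refine ⟨h, ?_⟩
    have : (⟨WeightedL2.incl hW (f + g), h⟩ : (daOp J hH hW).domain) =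
        ⟨WeightedL2.incl hW f, hf⟩ + ⟨WeightedL2.incl hW g, hg⟩ :=
      Subtype.ext (map_add _ _ _)
    rw [this, LinearPMap.map_add]
    exact add_mem hf' hg'
  smul_mem' := fun c f ⟨hf, hf'⟩ => by
    have h : WeightedL2.incl hW (c • f) ∈ (daOp J hH hW).domain := by
      rw [map_smul]; exact Submodule.smul_mem _ c hf
    refine ⟨h, ?_⟩
    have : (⟨WeightedL2.incl hW (c • f), h⟩ : (daOp J hH hW).domain) =
        c • ⟨WeightedL2.incl hW f, hf⟩ :=
      Subtype.ext (map_smul _ _ _)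
    rw [this, LinearPMap.map_smul]
    exact Submodule.smul_mem _ c hf'

/-- The maximal operator `L` generated by `𝓛`: the operator `Lf = 𝓛f` with domain `D(L)`. -/
def maximalOp (J : Matrix (Fin n) (Fin n) ℂ) (hH : MeasMat H) (hW : IsWeight W) :
    WeightedL2 hW →ₗ.[ℂ] WeightedL2 hW where
  domain := maximalDomain J hH hW
  toFun :=
    { toFun := fun f =>
        WeightedL2.of (daOp J hH hW ⟨WeightedL2.incl hW f.1, f.2.choose⟩) f.2.choose_spec
      map_add' := fun f g => WeightedL2.incl_injective <|
        (daOp J hH hW).map_add ⟨WeightedL2.incl hW f.1, f.2.choose⟩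
          ⟨WeightedL2.incl hW g.1, g.2.choose⟩
      map_smul' := fun c f => WeightedL2.incl_injective <|
        (daOp J hH hW).map_smul c ⟨WeightedL2.incl hW f.1, f.2.choose⟩ }

lemma incl_maximalOp {hH : MeasMat H} {hW : IsWeight W} (f : (maximalOp J hH hW).domain)
    (h : WeightedL2.incl hW f.1 ∈ (daOp J hH hW).domain) :
    WeightedL2.incl hW (maximalOp J hH hW f) = daOp J hH hW ⟨WeightedL2.incl hW f.1, h⟩ := rfl

/-- The minimal operator `L₀'` generated by `𝓛`: the restriction of `L` to those `f` for which
(the continuous representative of) `Jf` has compact support. -/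
def minimalOp (J : Matrix (Fin n) (Fin n) ℂ) (hH : MeasMat H) (hW : IsWeight W) :
    WeightedL2 hW →ₗ.[ℂ] WeightedL2 hW :=
  (maximalOp J hH hW).domRestrict
    { carrier := {f | ∃ u, IsACRep J (WeightedL2.incl hW f) u ∧ HasCompactSupport u}
      zero_mem' := ⟨0, by rw [map_zero]; exact IsACRep.zero, HasCompactSupport.zero⟩
      add_mem' := fun ⟨u, hu, hu'⟩ ⟨v, hv, hv'⟩ =>
        ⟨u + v, by rw [map_add]; exact hu.add hv, hu'.add hv'⟩
      smul_mem' := fun c _ ⟨u, hu, hu'⟩ =>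
        ⟨c • u, by rw [map_smul]; exact hu.const_smul c, hu'.smul_left (f := fun _ => c)⟩ }

end Operators

/-! ### Spectral notions for unbounded operators -/

/-- `ker (T - z)`, the eigenspace of the operator `T` for `z`. -/
def opEigenspace {E : Type*} [AddCommGroup E] [Module ℂ E] (T : E →ₗ.[ℂ] E) (z : ℂ) :
    Submodule ℂ E where
  carrier := {f | ∃ h : f ∈ T.domain, T ⟨f, h⟩ = z • f}
  zero_mem' := ⟨zero_mem _, by
    rw [smul_zero]; exact LinearPMap.map_zero T⟩
  add_mem' := fun {f g} ⟨hf, hf'⟩ ⟨hg, hg'⟩ => ⟨add_mem hf hg, by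
    rw [smul_add, ← hf', ← hg', ← LinearPMap.map_add]; rfl⟩
  smul_mem' := fun c f ⟨hf, hf'⟩ => ⟨Submodule.smul_mem _ c hf, by
    rw [smul_comm, ← hf', ← LinearPMap.map_smul]; rfl⟩

/-- `T` has no eigenvalues of finite multiplicity. -/
def NoFiniteMultiplicityEigenvalue {E : Type*} [AddCommGroup E] [Module ℂ E]
    (T : E →ₗ.[ℂ] E) : Prop :=
  ∀ z : ℂ, opEigenspace T z ≠ ⊥ → ¬ FiniteDimensional ℂ (opEigenspace T z)

end DAE

end

/-!
With respect to the splitting `ℂⁿ = ran J ⊕ ker J`, the equation `(Jf)' + (H - z W) f = W k`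
consists of a differential equation for the component `y` of `f` in `ran J` and an algebraic
equation, from which the component in `ker J` is eliminated. The index-1 hypotheses ensure that
the resulting equations `y' = A y + B κ`, `f = P y + Q κ`, with `κ = W^{1/2} k`, have `A ∈ L¹_loc`,
`B ∈ L²_loc`, `W^{1/2} P ∈ L²_loc` and `W^{1/2} Q ∈ L^∞_loc`
(`DAE.SchurConditions.reducedSystem`); the hypotheses for `z₀` imply those for its conjugate
(`DAE.SchurConditions.adjoint`). So initial value problems are uniquely solvable for both values
(`DAE.IsCaratheodory.exists_solution`, `DAE.IsCaratheodory.unique`), with locally square integrable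
`W^{1/2} f`.

Lagrange's identity (`DAE.ReducedSystem.integral_lagrange`) shows that the maximal operator `L` is
contained in the adjoint relation of the minimal operator `L₀'`. Conversely, for `(g, k)` in the
adjoint relation subtract from `g` a solution of the corresponding adjoint equation: on a compact
interval the difference is orthogonal to every function orthogonal to the homogeneous solutions,
because such functions are of the form `(L₀' - z₀) f`. The space of homogeneous solutions is
finite-dimensional, so the difference is one of them (`DAE.exists_isSolution_on_Icc`). Hence `L` is
the adjoint relation of `L₀'`, and as `L` is an operator, `L₀'` is densely defined.

The eigenspaces of `L` for `z₀` and its conjugate are finite-dimensional by unique solvability. By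
periodicity every eigenspace is invariant under translation by `d`. A nonzero finite-dimensional
one would contain an eigenvector of the translation, that is, a Bloch solution `f` with
`f(t + d) = μ f(t)`; then `|μ| = 1`, and the measure `|W^{1/2} f|² dt` would be finite, periodic and
nonzero, which is impossible (`DAE.opEigenspace_eq_bot`). This proves the last assertion, and shows
that both deficiency spaces of `L₀'` vanish, so that `L₀'` is essentially self-adjoint with closure
`L` (`DAE.topologicalClosure_graph_eq`).
-/

open MeasureTheory Matrix
open scoped MatrixOrder ComplexOrder LinearPMap

noncomputable section

namespace DAE

/-! ### Absolutely continuous functions and their derivatives -/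

section AbsolutelyContinuous

open Set Filter Topology

lemma absolutelyContinuousOnInterval_of_dist_le {X Y : Type*} [PseudoMetricSpace X]
    [PseudoMetricSpace Y] {f : ℝ → X} {g : ℝ → Y} {a b : ℝ}
    (hg : AbsolutelyContinuousOnInterval g a b)
    (h : ∀ s t, dist (f s) (f t) ≤ dist (g s) (g t)) : AbsolutelyContinuousOnInterval f a b := by
  refine squeeze_zero (fun _ => ?_) (fun _ => ?_) hg
  · exact Finset.sum_nonneg fun i _ => dist_nonneg
  · exact Finset.sum_le_sum fun i _ => h _ _

lemma intervalIntegrable_of_locallyIntegrable {E : Type*} [NormedAddCommGroup E] {f : ℝ → E}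
    (hf : LocallyIntegrable f volume)
    (a b : ℝ) : IntervalIntegrable f volume a b :=
  intervalIntegrable_iff.mpr <|
    (hf.integrableOn_isCompact isCompact_uIcc).mono_set uIoc_subset_uIcc

variable {E : Type*} [NormedAddCommGroup E] [NormedSpace ℝ E]

/-- The increments of a primitive are dominated by those of a primitive of the norm, which reduces
the vector-valued case to the real one. -/
lemma absolutelyContinuousOnInterval_primitive {f : ℝ → E} (hf : LocallyIntegrable f volume)
    (c a b : ℝ) : AbsolutelyContinuousOnInterval (fun t => ∫ s in c..t, f s) a b := by
  have hn : ∀ x y, IntervalIntegrable (fun s => ‖f s‖) volume x y := fun x y =>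
    (intervalIntegrable_of_locallyIntegrable hf x y).norm
  have h := (hn a b).absolutelyContinuousOnInterval_intervalIntegral (c := a) left_mem_uIcc
  refine absolutelyContinuousOnInterval_of_dist_le h fun s t => ?_
  have hi := intervalIntegrable_of_locallyIntegrable hf
  rw [dist_eq_norm, dist_eq_norm, intervalIntegral.integral_interval_sub_left (hi _ _) (hi _ _),
    intervalIntegral.integral_interval_sub_left (hn _ _) (hn _ _), Real.norm_eq_abs]
  exact intervalIntegral.norm_integral_le_abs_integral_norm

lemma eq_add_integral_of_ae_hasDerivAt [CompleteSpace E] {u r : ℝ → E}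
    (hu : ∀ a b, AbsolutelyContinuousOnInterval u a b) (hr : LocallyIntegrable r volume)
    (h : ∀ᵐ t, HasDerivAt u (r t) t) (a b : ℝ) : u b = u a + ∫ s in a..b, r s := by
  have hac := (hu a b).sub (absolutelyContinuousOnInterval_primitive hr a a b)
  obtain ⟨C, hC⟩ := hac.const_of_ae_hasDerivAt_zero (by
    filter_upwards [h, _root_.LocallyIntegrable.ae_hasDerivAt_integral hr] with t h1 h2 _
    simpa using h1.sub (h2 a))
  have h1 := hC a left_mem_uIcc
  have h2 := hC b right_mem_uIcc
  simp only [Pi.sub_apply, intervalIntegral.integral_same, sub_zero] at h1 h2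
  rw [h1, ← h2]; abel

end AbsolutelyContinuous

/-! ### Carathéodory differential equations -/

section Caratheodory

open Set

variable {E : Type*} [NormedAddCommGroup E]

/-- `F` is a right-hand side `y' = F(t, y)` of Carathéodory type with the locally integrable
function `β` as a Lipschitz and growth constant. -/
structure IsCaratheodory (F : ℝ → E → E) (β : ℝ → ℝ) : Prop where
  locallyIntegrable : LocallyIntegrable β volume
  nonneg : ∀ t, 0 ≤ β t
  meas : ∀ y : ℝ → E, Continuous y → AEStronglyMeasurable (fun t => F t (y t)) volume
  lipschitz : ∀ t x y, ‖F t x - F t y‖ ≤ β t * ‖x - y‖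
  norm_zero_le : ∀ t, ‖F t 0‖ ≤ β t

variable {β : ℝ → ℝ} {F : ℝ → E → E}

lemma IsCaratheodory.norm_le (hF : IsCaratheodory F β) (t : ℝ) (x : E) :
    ‖F t x‖ ≤ β t * (1 + ‖x‖) := by
  have h1 := hF.lipschitz t x 0
  have h2 := hF.norm_zero_le t
  have h3 := norm_sub_norm_le (F t x) (F t 0)
  rw [sub_zero] at h1
  linarith

lemma IsCaratheodory.locallyIntegrable_comp (hF : IsCaratheodory F β) {y : ℝ → E}
    (hy : Continuous y) : LocallyIntegrable (fun t => F t (y t)) volume := by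
  have h : LocallyIntegrable (fun t => β t * (1 + ‖y t‖)) volume := by
    intro x
    refine ⟨Icc (x - 1) (x + 1), Icc_mem_nhds (by linarith) (by linarith), ?_⟩
    exact (hF.locallyIntegrable.integrableOn_isCompact isCompact_Icc).mul_continuousOn
      (continuous_const.add hy.norm).continuousOn isCompact_Icc
  refine h.mono (hF.meas y hy) (Filter.Eventually.of_forall fun t => ?_)
  exact (hF.norm_le t _).trans (Real.le_norm_self _)

variable [NormedSpace ℝ E]

/-- The weight `exp(2 |∫ₐᵗ β|)`; relative to it the Picard map is a contraction on all of `ℝ`. -/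
def expWeight (β : ℝ → ℝ) (a t : ℝ) : ℝ := Real.exp (2 * |∫ s in a..t, β s|)

lemma one_le_expWeight (a t : ℝ) : 1 ≤ expWeight β a t := Real.one_le_exp (by positivity)

lemma expWeight_pos (a t : ℝ) : 0 < expWeight β a t := Real.exp_pos _

lemma continuous_primitive {f : ℝ → E} (hf : LocallyIntegrable f volume) (a : ℝ) :
    Continuous fun t => ∫ s in a..t, f s :=
  intervalIntegral.continuous_primitive (intervalIntegrable_of_locallyIntegrable hf) a

lemma continuous_expWeight (hβ : LocallyIntegrable β volume) (a : ℝ) :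
    Continuous (expWeight β a) :=
  Real.continuous_exp.comp (continuous_const.mul (continuous_primitive hβ a).abs)

/-- The function `σ exp(2σ ∫ₐˢ β)` is monotone for both signs `σ`, and the integral of the
derivative of a monotone function does not exceed its increment. -/
lemma abs_integral_mul_expWeight_le (hβ : LocallyIntegrable β volume) (h0 : ∀ t, 0 ≤ β t)
    (a t : ℝ) : |∫ s in a..t, β s * expWeight β a s| ≤ (expWeight β a t - 1) / 2 := by
  have hi := intervalIntegrable_of_locallyIntegrable hβ
  have hmono : Monotone fun s => ∫ x in a..s, β x := fun x y hxy => by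
    have : 0 ≤ ∫ s in x..y, β s := intervalIntegral.integral_nonneg hxy fun s _ => h0 s
    rw [← intervalIntegral.integral_interval_sub_left (hi a y) (hi a x)] at this
    exact sub_nonneg.1 this
  have key : ∀ σ : ℝ, σ = 1 ∨ σ = -1 →
      (∀ s ∈ uIcc a t, |∫ x in a..s, β x| = σ * ∫ x in a..s, β x) →
      |∫ s in a..t, β s * expWeight β a s| ≤ (expWeight β a t - 1) / 2 := by
    intro σ hσ hs
    have hσ2 : σ * σ = 1 := by rcases hσ with rfl | rfl <;> norm_num
    set M : ℝ → ℝ := fun s => σ * Real.exp (2 * (σ * ∫ x in a..s, β x)) with hM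
    have hMm : Monotone M := by
      intro x y hxy
      have := hmono hxy
      simp only [hM]
      rcases hσ with rfl | rfl
      · simp only [one_mul]; gcongr
      · simp only [neg_mul, one_mul, neg_le_neg_iff]
        gcongr
    have h1 := (hMm.monotoneOn (uIcc a t)).intervalIntegral_deriv_mem_uIcc
    have h2 : ∫ s in a..t, deriv M s = 2 * ∫ s in a..t, β s * expWeight β a s := by
      rw [← intervalIntegral.integral_const_mul]
      refine intervalIntegral.integral_congr_ae ?_
      filter_upwards [_root_.LocallyIntegrable.ae_hasDerivAt_integral hβ] with s h hst
      have h3 := ((((h a).const_mul σ).const_mul 2).exp.const_mul σ).deriv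
      rw [h3, expWeight, hs s (uIoc_subset_uIcc hst)]
      linear_combination (2 * β s * Real.exp (2 * (σ * ∫ x in a..s, β x))) * hσ2
    have h4 : |∫ s in a..t, deriv M s| ≤ |M t - M a| := by
      simpa using abs_sub_left_of_mem_uIcc h1
    have h5 : |M t - M a| = expWeight β a t - 1 := by
      have h6 := one_le_expWeight (β := β) a t
      have h7 : M t - M a = σ * (expWeight β a t - 1) := by
        simp only [hM, expWeight, hs t right_mem_uIcc]; simp; ring
      have h8 : |σ| = 1 := by rcases hσ with rfl | rfl <;> norm_num
      rw [h7, abs_mul, h8, one_mul, abs_of_nonneg (by linarith)]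
    rw [h2, h5, abs_mul, abs_two] at h4
    linarith
  rcases le_total a t with hat | hat
  · refine key 1 (Or.inl rfl) fun s hs => ?_
    rw [uIcc_of_le hat] at hs
    have := hmono hs.1
    simp only [intervalIntegral.integral_same] at this
    rw [abs_of_nonneg this, one_mul]
  · refine key (-1) (Or.inr rfl) fun s hs => ?_
    rw [uIcc_of_ge hat] at hs
    have := hmono hs.2
    simp only [intervalIntegral.integral_same] at this
    rw [abs_of_nonpos this, neg_one_mul]

lemma norm_integral_le_expWeight (hβ : LocallyIntegrable β volume) (h0 : ∀ t, 0 ≤ β t)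
    {a t C : ℝ} (hC : 0 ≤ C) {g : ℝ → E}
    (hg : ∀ s ∈ uIoc a t, ‖g s‖ ≤ C * (β s * expWeight β a s)) :
    ‖∫ s in a..t, g s‖ ≤ C * ((expWeight β a t - 1) / 2) := by
  have hint : IntervalIntegrable (fun s => C * (β s * expWeight β a s)) volume a t :=
    (((intervalIntegrable_of_locallyIntegrable hβ a t).mul_continuousOn
      (continuous_expWeight hβ a).continuousOn)).const_mul C
  refine (intervalIntegral.norm_integral_le_abs_of_norm_le ?_ hint).trans ?_
  · exact ae_restrict_of_forall_mem measurableSet_uIoc hg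
  · rw [intervalIntegral.integral_const_mul, abs_mul, abs_of_nonneg hC]
    exact mul_le_mul_of_nonneg_left (abs_integral_mul_expWeight_le hβ h0 a t) hC

lemma IsCaratheodory.unique (hF : IsCaratheodory F β) {y z : ℝ → E} (hy : Continuous y)
    (hz : Continuous z) {a b : ℝ} (hya : y a = z a)
    (hyb : ∀ t ∈ uIcc a b, y t = y a + ∫ s in a..t, F s (y s))
    (hzb : ∀ t ∈ uIcc a b, z t = z a + ∫ s in a..t, F s (z s)) : y b = z b := by
  set w : ℝ → ℝ := fun t => ‖y t - z t‖ / expWeight β a t with hw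
  have hwc : Continuous w := (hy.sub hz).norm.div (continuous_expWeight hF.locallyIntegrable a)
    fun t => (expWeight_pos a t).ne'
  obtain ⟨t₀, ht₀, hmax⟩ := (isCompact_uIcc (a := a) (b := b)).exists_isMaxOn
    ⟨a, left_mem_uIcc⟩ hwc.continuousOn
  have hM0 : 0 ≤ w t₀ := div_nonneg (norm_nonneg _) (expWeight_pos a t₀).le
  have hle : ∀ s ∈ uIcc a b, ‖y s - z s‖ ≤ w t₀ * expWeight β a s := fun s hs =>
    (div_le_iff₀ (expWeight_pos a s)).1 (hmax hs)
  have hi : ∀ v : ℝ → E, Continuous v → IntervalIntegrable (fun s => F s (v s)) volume a t₀ :=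
    fun v hv => intervalIntegrable_of_locallyIntegrable (hF.locallyIntegrable_comp hv) _ _
  have h1 : ‖y t₀ - z t₀‖ ≤ w t₀ * ((expWeight β a t₀ - 1) / 2) := by
    rw [hyb t₀ ht₀, hzb t₀ ht₀, hya, add_sub_add_left_eq_sub,
      ← intervalIntegral.integral_sub (hi y hy) (hi z hz)]
    refine norm_integral_le_expWeight hF.locallyIntegrable hF.nonneg hM0 fun s hs => ?_
    have hs' : s ∈ uIcc a b :=
      uIcc_subset_uIcc left_mem_uIcc ht₀ (uIoc_subset_uIcc hs)
    calc ‖F s (y s) - F s (z s)‖ ≤ β s * ‖y s - z s‖ := hF.lipschitz _ _ _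
      _ ≤ β s * (w t₀ * expWeight β a s) :=
          mul_le_mul_of_nonneg_left (hle s hs') (hF.nonneg s)
      _ = _ := by ring
  have h2 : ‖y t₀ - z t₀‖ = w t₀ * expWeight β a t₀ :=
    (div_mul_cancel₀ _ (expWeight_pos a t₀).ne').symm
  have h3 := one_le_expWeight (β := β) a t₀
  have h4 : w t₀ ≤ 0 := by nlinarith
  have h5 := hle b right_mem_uIcc
  rw [le_antisymm h4 hM0, zero_mul] at h5
  exact sub_eq_zero.1 (norm_le_zero_iff.1 h5)

/-- Global solutions exist: in the unknown `v = y / expWeight`, the Picard map is a contraction of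
the bounded continuous functions on `ℝ` with constant `1 / 2`. -/
lemma IsCaratheodory.exists_solution [CompleteSpace E] (hF : IsCaratheodory F β) (a : ℝ) (c : E) :
    ∃ y : ℝ → E, Continuous y ∧ ∀ t, y t = c + ∫ s in a..t, F s (y s) := by
  have hβ := hF.locallyIntegrable
  have hEc := continuous_expWeight hβ a
  have hcont : ∀ v : BoundedContinuousFunction ℝ E,
      Continuous fun s => expWeight β a s • v s := fun v => hEc.smul v.continuous
  have hint : ∀ v : BoundedContinuousFunction ℝ E,
      LocallyIntegrable (fun s => F s (expWeight β a s • v s)) volume := fun v =>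
    hF.locallyIntegrable_comp (hcont v)
  have hbound : ∀ (v : BoundedContinuousFunction ℝ E) (t : ℝ),
      ‖(expWeight β a t)⁻¹ • (c + ∫ s in a..t, F s (expWeight β a s • v s))‖ ≤
        ‖c‖ + (1 + ‖v‖) := by
    intro v t
    have h1 := one_le_expWeight (β := β) a t
    have hp := expWeight_pos (β := β) a t
    have h2 : ‖∫ s in a..t, F s (expWeight β a s • v s)‖ ≤
        (1 + ‖v‖) * ((expWeight β a t - 1) / 2) := by
      refine norm_integral_le_expWeight hβ hF.nonneg (by positivity) fun s _ => ?_
      refine (hF.norm_le s _).trans ?_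
      have h3 := one_le_expWeight (β := β) a s
      rw [norm_smul, Real.norm_of_nonneg (by linarith)]
      have h4 : expWeight β a s * ‖v s‖ ≤ expWeight β a s * ‖v‖ :=
        mul_le_mul_of_nonneg_left (v.norm_coe_le_norm s) (by linarith)
      calc β s * (1 + expWeight β a s * ‖v s‖)
          ≤ β s * (expWeight β a s + expWeight β a s * ‖v‖) :=
            mul_le_mul_of_nonneg_left (by linarith) (hF.nonneg s)
        _ = _ := by ring
    rw [norm_smul, norm_inv, Real.norm_of_nonneg hp.le, inv_mul_le_iff₀ hp]
    refine (norm_add_le _ _).trans ?_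
    have h5 : 0 ≤ ‖v‖ := norm_nonneg v
    have h6 : 0 ≤ ‖c‖ := norm_nonneg c
    nlinarith
  let Φ : BoundedContinuousFunction ℝ E → BoundedContinuousFunction ℝ E := fun v =>
    BoundedContinuousFunction.ofNormedAddCommGroup
      (fun t => (expWeight β a t)⁻¹ • (c + ∫ s in a..t, F s (expWeight β a s • v s)))
      ((hEc.inv₀ fun t => (expWeight_pos a t).ne').smul
        (continuous_const.add (continuous_primitive (hint v) a))) _ (hbound v)
  have hΦ : ∀ v t, Φ v t =
      (expWeight β a t)⁻¹ • (c + ∫ s in a..t, F s (expWeight β a s • v s)) := fun _ _ => rfl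
  have hcontr : ContractingWith (1 / 2) Φ := by
    refine ⟨by norm_num, LipschitzWith.of_dist_le_mul fun v w => ?_⟩
    refine (BoundedContinuousFunction.dist_le (by positivity)).2 fun t => ?_
    have hp := expWeight_pos (β := β) a t
    have hi : ∀ v : BoundedContinuousFunction ℝ E,
        IntervalIntegrable (fun s => F s (expWeight β a s • v s)) volume a t :=
      fun v => intervalIntegrable_of_locallyIntegrable (hint v) _ _
    rw [dist_eq_norm, hΦ, hΦ, ← smul_sub, add_sub_add_left_eq_sub,
      ← intervalIntegral.integral_sub (hi v) (hi w), norm_smul, norm_inv,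
      Real.norm_of_nonneg hp.le, inv_mul_le_iff₀ hp]
    have h2 : ‖∫ s in a..t, (F s (expWeight β a s • v s) - F s (expWeight β a s • w s))‖ ≤
        dist v w * ((expWeight β a t - 1) / 2) := by
      refine norm_integral_le_expWeight hβ hF.nonneg dist_nonneg fun s _ => ?_
      refine (hF.lipschitz s _ _).trans ?_
      rw [← smul_sub, norm_smul, Real.norm_of_nonneg (expWeight_pos a s).le, ← dist_eq_norm]
      have h4 : expWeight β a s * dist (v s) (w s) ≤ expWeight β a s * dist v w :=
        mul_le_mul_of_nonneg_left (BoundedContinuousFunction.dist_coe_le_dist (f := v) (g := w) s)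
          (expWeight_pos a s).le
      calc β s * (expWeight β a s * dist (v s) (w s))
          ≤ β s * (expWeight β a s * dist v w) := mul_le_mul_of_nonneg_left h4 (hF.nonneg s)
        _ = _ := by ring
    refine h2.trans ?_
    have h5 : (0 : ℝ) ≤ dist v w := dist_nonneg
    push_cast
    nlinarith
  set v := ContractingWith.fixedPoint Φ hcontr with hv
  refine ⟨fun t => expWeight β a t • v t, hcont v, fun t => ?_⟩
  have h := congrArg (fun g : BoundedContinuousFunction ℝ E => g t)
    (ContractingWith.fixedPoint_isFixedPt (f := Φ) hcontr)
  simp only [hΦ] at h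
  rw [← hv] at h
  simp only
  rw [← h, smul_inv_smul₀ (expWeight_pos a t).ne']

end Caratheodory

/-! ### Local Lebesgue spaces of matrix functions -/

section LocalLp

variable {m k l : Type*}

lemma MemLpLoc.congr {p : ENNReal} {A B : ℝ → Matrix m k ℂ} (hA : MemLpLoc p A)
    (h : ∀ᵐ t, A t = B t) : MemLpLoc p B := fun i j a b =>
  (hA i j a b).ae_eq (ae_restrict_of_ae (h.mono fun t ht => by rw [ht]))

lemma MemLpLoc.add {p : ENNReal} {A B : ℝ → Matrix m k ℂ} (hA : MemLpLoc p A)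
    (hB : MemLpLoc p B) : MemLpLoc p fun t => A t + B t := fun i j a b =>
  (hA i j a b).add (hB i j a b)

lemma MemLpLoc.sub {p : ENNReal} {A B : ℝ → Matrix m k ℂ} (hA : MemLpLoc p A)
    (hB : MemLpLoc p B) : MemLpLoc p fun t => A t - B t := fun i j a b =>
  (hA i j a b).sub (hB i j a b)

lemma MemLpLoc.mul [Fintype k] {p q r : ENNReal} [ENNReal.HolderTriple p q r]
    {A : ℝ → Matrix m k ℂ} {B : ℝ → Matrix k l ℂ} (hA : MemLpLoc p A) (hB : MemLpLoc q B) :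
    MemLpLoc r fun t => A t * B t := fun i j a b => by
  simp only [Matrix.mul_apply]
  exact memLp_finsetSum _ fun x _ => (hB x j a b).mul (hA i x a b)

lemma MemLpLoc.conjTranspose {p : ENNReal} {A : ℝ → Matrix m k ℂ} (hA : MemLpLoc p A) :
    MemLpLoc p fun t => (A t)ᴴ := fun i j a b => (hA j i a b).star

lemma MeasMat.memLpLoc_top_of_norm_le {A : ℝ → Matrix m k ℂ} (hA : MeasMat A) (C : ℝ)
    (h : ∀ᵐ t, ∀ i j, ‖A t i j‖ ≤ C) : MemLpLoc ⊤ A := fun i j _ _ =>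
  memLp_top_of_bound (hA i j).aestronglyMeasurable.restrict C
    (ae_restrict_of_ae (h.mono fun _ ht => ht i j))

lemma memLpLoc_top_const [Finite m] [Finite k] (C : Matrix m k ℂ) :
    MemLpLoc ⊤ fun _ : ℝ => C := fun i j _ _ =>
  memLp_top_of_bound aestronglyMeasurable_const ‖C i j‖ (Filter.Eventually.of_forall fun _ => le_rfl)

lemma measMat_const (C : Matrix m k ℂ) : MeasMat fun _ : ℝ => C :=
  fun _ _ => aemeasurable_const

lemma MeasMat.sub {A B : ℝ → Matrix m k ℂ} (hA : MeasMat A) (hB : MeasMat B) :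
    MeasMat fun t => A t - B t := fun i j => (hA i j).sub (hB i j)

lemma MeasMat.mul [Fintype k] {A : ℝ → Matrix m k ℂ} {B : ℝ → Matrix k l ℂ} (hA : MeasMat A)
    (hB : MeasMat B) : MeasMat fun t => A t * B t := fun i j => by
  simp only [Matrix.mul_apply]
  exact Finset.aemeasurable_fun_sum _ fun x _ => (hA i x).mul (hB x j)

lemma MeasMat.conjTranspose {A : ℝ → Matrix m k ℂ} (hA : MeasMat A) :
    MeasMat fun t => (A t)ᴴ := fun i j =>
  continuous_star.measurable.comp_aemeasurable (hA j i)

/-- The squares of the entries of `A` are bounded by the diagonal of `A Aᴴ`. -/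
lemma norm_sq_le_mul_conjTranspose [Fintype k] (A : Matrix m k ℂ) (i : m) (j : k) :
    ‖A i j‖ ^ 2 ≤ ‖(A * Aᴴ) i i‖ := by
  have h : (A * Aᴴ) i i = ((∑ j, ‖A i j‖ ^ 2 : ℝ) : ℂ) := by
    rw [Matrix.mul_apply]
    push_cast
    refine Finset.sum_congr rfl fun x _ => ?_
    rw [Matrix.conjTranspose_apply, Complex.star_def, Complex.mul_conj']
  rw [h, Complex.norm_real, Real.norm_of_nonneg (Finset.sum_nonneg fun _ _ => by positivity)]
  exact Finset.single_le_sum (f := fun j => ‖A i j‖ ^ 2) (fun _ _ => by positivity)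
    (Finset.mem_univ j)

lemma MeasMat.memLpLoc_two_of_mul_conjTranspose [Fintype k] {A : ℝ → Matrix m k ℂ}
    (hA : MeasMat A) (h : MemLpLoc 1 fun t => A t * (A t)ᴴ) : MemLpLoc 2 A := fun i j a b => by
  rw [memLp_two_iff_integrable_sq_norm (hA i j).aestronglyMeasurable.restrict]
  refine (memLp_one_iff_integrable.1 (h i i a b)).mono
    ((hA i j).norm.pow_const 2).aestronglyMeasurable.restrict
    (Filter.Eventually.of_forall fun t => ?_)
  rw [Real.norm_of_nonneg (by positivity)]
  exact norm_sq_le_mul_conjTranspose _ _ _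

end LocalLp

/-! ### Reduction of the differential-algebraic equation to an ordinary one -/

section Reduction

variable {n m m₂ : ℕ}

/-- The columns of `ι` and `ι₂` together form an orthonormal basis. -/
structure IsSplit (ι : Matrix (Fin n) (Fin m) ℂ) (ι₂ : Matrix (Fin n) (Fin m₂) ℂ) : Prop where
  h11 : ιᴴ * ι = 1
  h22 : ι₂ᴴ * ι₂ = 1
  h12 : ιᴴ * ι₂ = 0
  h21 : ι₂ᴴ * ι = 0
  sum : ι * ιᴴ + ι₂ * ι₂ᴴ = 1

/-- The equation `ι J₁ y' + K x = W^{1/2} κ`, where `y = ιᴴ x`, in solved form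
`y' = A y + B κ`, `x = P y + Q κ`. The integrability of the coefficients is what makes `W^{1/2} x`
locally square integrable whenever `κ` is. -/
structure ReducedSystem (ι : Matrix (Fin n) (Fin m) ℂ) (J₁ : Matrix (Fin m) (Fin m) ℂ)
    (K W : ℝ → Matrix (Fin n) (Fin n) ℂ) where
  A : ℝ → Matrix (Fin m) (Fin m) ℂ
  B : ℝ → Matrix (Fin m) (Fin n) ℂ
  P : ℝ → Matrix (Fin n) (Fin m) ℂ
  Q : ℝ → Matrix (Fin n) (Fin n) ℂ
  memA : MemLpLoc 1 A
  memB : MemLpLoc 2 B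
  memGP : MemLpLoc 2 fun t => CFC.sqrt (W t) * P t
  memGQ : MemLpLoc ⊤ fun t => CFC.sqrt (W t) * Q t
  measP : MeasMat P
  measQ : MeasMat Q
  mul_P : ∀ t, ιᴴ * P t = 1
  mul_Q : ∀ t, ιᴴ * Q t = 0
  solve : ∀ᵐ t, ∀ (x : Fin n → ℂ) (y' : Fin m → ℂ) (κ : Fin n → ℂ),
    ι *ᵥ (J₁ *ᵥ y') + K t *ᵥ x = CFC.sqrt (W t) *ᵥ κ ↔
      x = P t *ᵥ (ιᴴ *ᵥ x) + Q t *ᵥ κ ∧ y' = A t *ᵥ (ιᴴ *ᵥ x) + B t *ᵥ κ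

/-- The part of the index-1 hypotheses on the blocks `Kᵢⱼ = ιᵢᴴ K ιⱼ` that is used. It is invariant
under passing from `K` to `Kᴴ`. -/
structure SchurConditions (ι : Matrix (Fin n) (Fin m) ℂ) (ι₂ : Matrix (Fin n) (Fin m₂) ℂ)
    (K W : ℝ → Matrix (Fin n) (Fin n) ℂ) : Prop where
  det : ∀ᵐ t, (ι₂ᴴ * K t * ι₂).det ≠ 0
  left : MemLpLoc 2 fun t =>
    (ιᴴ * K t * ι₂) * (ι₂ᴴ * K t * ι₂)⁻¹ * CFC.sqrt (ι₂ᴴ * W t * ι₂)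
  right : MemLpLoc 2 fun t =>
    CFC.sqrt (ι₂ᴴ * W t * ι₂) * ((ι₂ᴴ * K t * ι₂)⁻¹ * (ι₂ᴴ * K t * ι))
  center : MemLpLoc ⊤ fun t =>
    CFC.sqrt (ι₂ᴴ * W t * ι₂) * (ι₂ᴴ * K t * ι₂)⁻¹ * CFC.sqrt (ι₂ᴴ * W t * ι₂)
  schur : MemLpLoc 1 fun t =>
    ιᴴ * K t * ι - (ιᴴ * K t * ι₂) * (ι₂ᴴ * K t * ι₂)⁻¹ * (ι₂ᴴ * K t * ι)
  weight : MemLpLoc 1 fun t => ιᴴ * W t * ι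

variable {ι : Matrix (Fin n) (Fin m) ℂ} {ι₂ : Matrix (Fin n) (Fin m₂) ℂ}
  {J₁ : Matrix (Fin m) (Fin m) ℂ} {K W : ℝ → Matrix (Fin n) (Fin n) ℂ}

lemma sqrt_conjTranspose {k : ℕ} (M : Matrix (Fin k) (Fin k) ℂ) :
    (CFC.sqrt M)ᴴ = CFC.sqrt M :=
  (CFC.sqrt_nonneg M).posSemidef.1

lemma IsWeight.posDef (hW : IsWeight W) : ∀ᵐ t, (W t).PosDef := by
  filter_upwards [hW.posSemidef, hW.det_ne_zero] with t h1 h2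
  exact h1.posDef_iff_isUnit.2 ((Matrix.isUnit_iff_isUnit_det _).2 (isUnit_iff_ne_zero.2 h2))

/-- The matrix `U = W₂₂^{-1/2} ι₂ᴴ W^{1/2}`, a coisometry. -/
def coIsometry (ι₂ : Matrix (Fin n) (Fin m₂) ℂ) (W : ℝ → Matrix (Fin n) (Fin n) ℂ) (t : ℝ) :
    Matrix (Fin m₂) (Fin n) ℂ :=
  (CFC.sqrt (ι₂ᴴ * W t * ι₂))⁻¹ * (ι₂ᴴ * CFC.sqrt (W t))

lemma IsSplit.sqrt_block (hs : IsSplit ι ι₂) (hW : IsWeight W) :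
    ∀ᵐ t, CFC.sqrt (ι₂ᴴ * W t * ι₂) * CFC.sqrt (ι₂ᴴ * W t * ι₂) = ι₂ᴴ * W t * ι₂ ∧
      IsUnit (CFC.sqrt (ι₂ᴴ * W t * ι₂)).det := by
  filter_upwards [hW.posDef] with t ht
  have hinj : Function.Injective ι₂.mulVec := by
    intro x y hxy
    have := congrArg (ι₂ᴴ *ᵥ ·) hxy
    simpa [Matrix.mulVec_mulVec, hs.h22] using this
  have hpd : (ι₂ᴴ * W t * ι₂).PosDef := ht.conjTranspose_mul_mul_same hinj
  have h1 := CFC.sqrt_mul_sqrt_self (ι₂ᴴ * W t * ι₂) hpd.posSemidef.nonneg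
  refine ⟨h1, ?_⟩
  have h2 : IsUnit (ι₂ᴴ * W t * ι₂).det := (Matrix.isUnit_iff_isUnit_det _).1 hpd.isUnit
  rw [← h1, Matrix.det_mul] at h2
  exact isUnit_of_mul_isUnit_left h2

lemma IsWeight.sqrt_mul_self (hW : IsWeight W) :
    ∀ᵐ t, CFC.sqrt (W t) * CFC.sqrt (W t) = W t :=
  hW.posSemidef.mono fun _ ht => CFC.sqrt_mul_sqrt_self _ ht.nonneg

lemma IsWeight.meas_sqrt_block (hW : IsWeight W) (ι₂ : Matrix (Fin n) (Fin m₂) ℂ) :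
    MeasMat fun t => CFC.sqrt (ι₂ᴴ * W t * ι₂) :=
  (((measMat_const ι₂ᴴ).mul hW.meas).mul (measMat_const ι₂)).sqrt
    (hW.posSemidef.mono fun _ ht => ht.conjTranspose_mul_mul_same ι₂)

lemma IsSplit.memLpLoc_coIsometry (hs : IsSplit ι ι₂) (hW : IsWeight W) :
    MemLpLoc ⊤ (coIsometry ι₂ W) := by
  refine MeasMat.memLpLoc_top_of_norm_le ((hW.meas_sqrt_block ι₂).inv.mul
    ((measMat_const ι₂ᴴ).mul (hW.meas.sqrt hW.posSemidef))) 1 ?_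
  filter_upwards [hs.sqrt_block hW, hW.sqrt_mul_self] with t ⟨h1, h2⟩ h3 i j
  have h4 : coIsometry ι₂ W t * (coIsometry ι₂ W t)ᴴ = 1 := by
    simp only [coIsometry, Matrix.conjTranspose_mul, Matrix.conjTranspose_conjTranspose,
      Matrix.conjTranspose_nonsing_inv, sqrt_conjTranspose]
    calc _ = (CFC.sqrt (ι₂ᴴ * W t * ι₂))⁻¹ * (ι₂ᴴ * (CFC.sqrt (W t) * CFC.sqrt (W t)) * ι₂) *
          (CFC.sqrt (ι₂ᴴ * W t * ι₂))⁻¹ := by simp only [Matrix.mul_assoc]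
      _ = 1 := by
        rw [h3]
        generalize CFC.sqrt (ι₂ᴴ * W t * ι₂) = R at h1 h2
        rw [← h1, Matrix.nonsing_inv_mul_cancel_left _ _ h2, Matrix.mul_nonsing_inv _ h2]
  have h5 := norm_sq_le_mul_conjTranspose (coIsometry ι₂ W t) i j
  rw [h4, Matrix.one_apply_eq, norm_one] at h5
  exact (sq_le_one_iff₀ (norm_nonneg _)).1 h5

lemma IsSplit.sqrt_mul_coIsometry (hs : IsSplit ι ι₂) (hW : IsWeight W) :
    ∀ᵐ t, CFC.sqrt (ι₂ᴴ * W t * ι₂) * coIsometry ι₂ W t = ι₂ᴴ * CFC.sqrt (W t) := by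
  filter_upwards [hs.sqrt_block hW] with t ⟨_, h2⟩
  rw [coIsometry, Matrix.mul_nonsing_inv_cancel_left _ _ h2]

lemma memLpLoc_mul_sqrt (hW : IsWeight W) (h : MemLpLoc 1 fun t => ιᴴ * W t * ι) :
    MemLpLoc 2 fun t => ιᴴ * CFC.sqrt (W t) := by
  refine ((measMat_const ιᴴ).mul
    (hW.meas.sqrt hW.posSemidef)).memLpLoc_two_of_mul_conjTranspose (h.congr ?_)
  filter_upwards [hW.sqrt_mul_self] with t ht
  nth_rw 1 [← ht]
  simp only [Matrix.conjTranspose_mul, sqrt_conjTranspose, Matrix.conjTranspose_conjTranspose,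
    Matrix.mul_assoc]

lemma IsSplit.schurConditions (hs : IsSplit ι ι₂) (hW : IsWeight W)
    (h : BlockIndexOne (fun t => ιᴴ * K t * ι) (fun t => ιᴴ * W t * ι)
      (fun t => ιᴴ * K t * ι₂) (fun t => ιᴴ * W t * ι₂) (fun t => ι₂ᴴ * K t * ι)
      (fun t => ι₂ᴴ * W t * ι) (fun t => ι₂ᴴ * K t * ι₂) (fun t => ι₂ᴴ * W t * ι₂)) :
    SchurConditions ι ι₂ K W where
  det := h.det_H₂₂
  left := h.memL2_left
  center := h.memLtop
  schur := h.schur_H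
  weight := h.memL1_W₁₁
  right := by
    have h1 : MemLpLoc 2 fun t => coIsometry ι₂ W t * (ιᴴ * CFC.sqrt (W t))ᴴ :=
      (hs.memLpLoc_coIsometry hW).mul (memLpLoc_mul_sqrt hW h.memL1_W₁₁).conjTranspose
    refine (h1.sub h.memL2_right).congr ?_
    filter_upwards [hs.sqrt_block hW, hW.sqrt_mul_self] with t ⟨h2, h3⟩ h4
    -- `W₂₂^{1/2} W₂₂⁻¹ W₂₁ = U (ιᴴ W^{1/2})ᴴ`
    have h5 : CFC.sqrt (ι₂ᴴ * W t * ι₂) * ((ι₂ᴴ * W t * ι₂)⁻¹ * (ι₂ᴴ * W t * ι)) =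
        coIsometry ι₂ W t * (ιᴴ * CFC.sqrt (W t))ᴴ := by
      nth_rw 2 [← h2]
      rw [Matrix.mul_inv_rev, Matrix.mul_assoc _ _ (ι₂ᴴ * W t * ι),
        Matrix.mul_nonsing_inv_cancel_left _ _ h3, coIsometry]
      simp only [Matrix.conjTranspose_mul, sqrt_conjTranspose,
        Matrix.conjTranspose_conjTranspose, Matrix.mul_assoc]
      rw [← Matrix.mul_assoc (CFC.sqrt (W t)) (CFC.sqrt (W t)), h4]
    rw [Matrix.mul_sub, h5, sub_sub_cancel]

lemma SchurConditions.adjoint (h : SchurConditions ι ι₂ K W) {K' : ℝ → Matrix (Fin n) (Fin n) ℂ}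
    (hK : ∀ᵐ t, K' t = (K t)ᴴ) : SchurConditions ι ι₂ K' W where
  det := by
    filter_upwards [h.det, hK] with t h1 h2
    have : ι₂ᴴ * K' t * ι₂ = (ι₂ᴴ * K t * ι₂)ᴴ := by
      simp [h2, Matrix.mul_assoc]
    rw [this, Matrix.det_conjTranspose]
    exact star_ne_zero.2 h1
  left := by
    refine h.right.conjTranspose.congr (hK.mono fun t h2 => ?_)
    simp [h2, Matrix.mul_assoc, sqrt_conjTranspose, Matrix.conjTranspose_nonsing_inv]
  right := by
    refine h.left.conjTranspose.congr (hK.mono fun t h2 => ?_)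
    simp [h2, Matrix.mul_assoc, sqrt_conjTranspose, Matrix.conjTranspose_nonsing_inv]
  center := by
    refine h.center.conjTranspose.congr (hK.mono fun t h2 => ?_)
    simp [h2, Matrix.mul_assoc, sqrt_conjTranspose, Matrix.conjTranspose_nonsing_inv]
  schur := by
    refine h.schur.conjTranspose.congr (hK.mono fun t h2 => ?_)
    simp [h2, Matrix.mul_assoc, Matrix.conjTranspose_nonsing_inv]
  weight := h.weight

/-- Elimination of the algebraic variable `ι₂ᴴ x`. -/
lemma IsSplit.solve_iff (hs : IsSplit ι ι₂) (hJ₁ : IsUnit J₁.det)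
    {k g : Matrix (Fin n) (Fin n) ℂ} (hk : IsUnit (ι₂ᴴ * k * ι₂).det)
    (x : Fin n → ℂ) (y' : Fin m → ℂ) (κ : Fin n → ℂ) :
    ι *ᵥ (J₁ *ᵥ y') + k *ᵥ x = g *ᵥ κ ↔
      x = (ι - ι₂ * ((ι₂ᴴ * k * ι₂)⁻¹ * (ι₂ᴴ * k * ι))) *ᵥ (ιᴴ *ᵥ x) +
          (ι₂ * ((ι₂ᴴ * k * ι₂)⁻¹ * (ι₂ᴴ * g))) *ᵥ κ ∧
        y' = (-J₁⁻¹ * (ιᴴ * k * ι - (ιᴴ * k * ι₂) * (ι₂ᴴ * k * ι₂)⁻¹ * (ι₂ᴴ * k * ι))) *ᵥ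
            (ιᴴ *ᵥ x) +
          (J₁⁻¹ * (ιᴴ * g - (ιᴴ * k * ι₂) * (ι₂ᴴ * k * ι₂)⁻¹ * (ι₂ᴴ * g))) *ᵥ κ := by
  set k₁₁ := ιᴴ * k * ι with hk11
  set k₁₂ := ιᴴ * k * ι₂ with hk12
  set k₂₁ := ι₂ᴴ * k * ι with hk21
  set k₂₂ := ι₂ᴴ * k * ι₂ with hk22
  set x₁ := ιᴴ *ᵥ x with hx1
  set x₂ := ι₂ᴴ *ᵥ x with hx2
  have hx : x = ι *ᵥ x₁ + ι₂ *ᵥ x₂ := by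
    rw [hx1, hx2, Matrix.mulVec_mulVec, Matrix.mulVec_mulVec, ← Matrix.add_mulVec, hs.sum,
      Matrix.one_mulVec]
  have hkx1 : ιᴴ *ᵥ (k *ᵥ x) = k₁₁ *ᵥ x₁ + k₁₂ *ᵥ x₂ := by
    rw [hx]; simp only [Matrix.mulVec_add, Matrix.mulVec_mulVec, hk11, hk12, Matrix.mul_assoc]
  have hkx2 : ι₂ᴴ *ᵥ (k *ᵥ x) = k₂₁ *ᵥ x₁ + k₂₂ *ᵥ x₂ := by
    rw [hx]; simp only [Matrix.mulVec_add, Matrix.mulVec_mulVec, hk21, hk22, Matrix.mul_assoc]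
  have hsplit : ∀ u v : Fin n → ℂ, u = v ↔ ιᴴ *ᵥ u = ιᴴ *ᵥ v ∧ ι₂ᴴ *ᵥ u = ι₂ᴴ *ᵥ v := by
    refine fun u v => ⟨fun h => by simp [h], fun ⟨h1, h2⟩ => ?_⟩
    have : ∀ w : Fin n → ℂ, w = ι *ᵥ (ιᴴ *ᵥ w) + ι₂ *ᵥ (ι₂ᴴ *ᵥ w) := fun w => by
      rw [Matrix.mulVec_mulVec, Matrix.mulVec_mulVec, ← Matrix.add_mulVec, hs.sum,
        Matrix.one_mulVec]
    rw [this u, this v, h1, h2]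
  have e1 : (ι *ᵥ (J₁ *ᵥ y') + k *ᵥ x = g *ᵥ κ) ↔
      J₁ *ᵥ y' + (k₁₁ *ᵥ x₁ + k₁₂ *ᵥ x₂) = (ιᴴ * g) *ᵥ κ ∧
        k₂₁ *ᵥ x₁ + k₂₂ *ᵥ x₂ = (ι₂ᴴ * g) *ᵥ κ := by
    rw [hsplit]
    simp only [Matrix.mulVec_add, hkx1, hkx2]
    simp only [Matrix.mulVec_mulVec, ← Matrix.mul_assoc, hs.h11, hs.h21, Matrix.one_mul,
      Matrix.zero_mul, Matrix.zero_mulVec, zero_add]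
  have e2 : (x = (ι - ι₂ * (k₂₂⁻¹ * k₂₁)) *ᵥ x₁ + (ι₂ * (k₂₂⁻¹ * (ι₂ᴴ * g))) *ᵥ κ) ↔
      x₂ = k₂₂⁻¹ *ᵥ ((ι₂ᴴ * g) *ᵥ κ - k₂₁ *ᵥ x₁) := by
    rw [hsplit]
    simp only [Matrix.mulVec_add, Matrix.mulVec_sub, Matrix.sub_mulVec, Matrix.mulVec_mulVec,
      ← Matrix.mul_assoc, hs.h11, hs.h21, hs.h12, hs.h22, Matrix.one_mul, Matrix.zero_mul,
      Matrix.zero_mulVec, Matrix.one_mulVec, sub_zero, add_zero, zero_sub]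
    rw [← hx1, ← hx2]
    simp only [true_and]
    rw [neg_add_eq_sub]
  have e3 : (k₂₁ *ᵥ x₁ + k₂₂ *ᵥ x₂ = (ι₂ᴴ * g) *ᵥ κ) ↔
      x₂ = k₂₂⁻¹ *ᵥ ((ι₂ᴴ * g) *ᵥ κ - k₂₁ *ᵥ x₁) := by
    constructor
    · intro h
      rw [← h, add_sub_cancel_left, Matrix.mulVec_mulVec, Matrix.nonsing_inv_mul _ hk,
        Matrix.one_mulVec]
    · intro h
      rw [h, Matrix.mulVec_mulVec _ k₂₂ k₂₂⁻¹, Matrix.mul_nonsing_inv _ hk, Matrix.one_mulVec,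
        add_sub_cancel]
  rw [e1, e2, e3, and_comm]
  refine and_congr_right fun h => ?_
  have e4 : (-J₁⁻¹ * (k₁₁ - k₁₂ * k₂₂⁻¹ * k₂₁)) *ᵥ x₁ +
      (J₁⁻¹ * (ιᴴ * g - k₁₂ * k₂₂⁻¹ * (ι₂ᴴ * g))) *ᵥ κ =
      J₁⁻¹ *ᵥ ((ιᴴ * g) *ᵥ κ - (k₁₁ *ᵥ x₁ + k₁₂ *ᵥ x₂)) := by
    rw [h]
    simp only [Matrix.mulVec_add, Matrix.mulVec_sub, Matrix.sub_mulVec, Matrix.mulVec_mulVec,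
      Matrix.mul_sub, Matrix.neg_mul, Matrix.neg_mulVec, Matrix.mul_assoc]
    abel
  rw [e4]
  constructor
  · intro h'
    rw [← h', add_sub_cancel_right, Matrix.mulVec_mulVec, Matrix.nonsing_inv_mul _ hJ₁,
      Matrix.one_mulVec]
  · intro h'
    rw [h', Matrix.mulVec_mulVec, Matrix.mul_nonsing_inv _ hJ₁, Matrix.one_mulVec,
      sub_add_cancel]

/-- The reduced system of a matrix function satisfying the index-1 hypotheses. -/
def SchurConditions.reducedSystem (h : SchurConditions ι ι₂ K W) (hs : IsSplit ι ι₂)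
    (hW : IsWeight W) (hK : MeasMat K) (hJ₁ : IsUnit J₁.det) : ReducedSystem ι J₁ K W where
  A t := -J₁⁻¹ * (ιᴴ * K t * ι - (ιᴴ * K t * ι₂) * (ι₂ᴴ * K t * ι₂)⁻¹ * (ι₂ᴴ * K t * ι))
  B t := J₁⁻¹ * (ιᴴ * CFC.sqrt (W t) -
    (ιᴴ * K t * ι₂) * (ι₂ᴴ * K t * ι₂)⁻¹ * (ι₂ᴴ * CFC.sqrt (W t)))
  P t := ι - ι₂ * ((ι₂ᴴ * K t * ι₂)⁻¹ * (ι₂ᴴ * K t * ι))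
  Q t := ι₂ * ((ι₂ᴴ * K t * ι₂)⁻¹ * (ι₂ᴴ * CFC.sqrt (W t)))
  memA := (memLpLoc_top_const (-J₁⁻¹)).mul h.schur
  memB := by
    have h1 : MemLpLoc 2 fun t => (ιᴴ * K t * ι₂) * (ι₂ᴴ * K t * ι₂)⁻¹ *
        CFC.sqrt (ι₂ᴴ * W t * ι₂) * coIsometry ι₂ W t :=
      h.left.mul (hs.memLpLoc_coIsometry hW)
    refine (memLpLoc_top_const J₁⁻¹).mul ((memLpLoc_mul_sqrt hW h.weight).sub (h1.congr ?_))
    filter_upwards [hs.sqrt_mul_coIsometry hW] with t ht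
    rw [Matrix.mul_assoc _ (CFC.sqrt _), ht]
  memGP := by
    have h1 : MemLpLoc 2 fun t => (coIsometry ι₂ W t)ᴴ *
        (CFC.sqrt (ι₂ᴴ * W t * ι₂) * ((ι₂ᴴ * K t * ι₂)⁻¹ * (ι₂ᴴ * K t * ι))) :=
      (hs.memLpLoc_coIsometry hW).conjTranspose.mul h.right
    refine ((memLpLoc_mul_sqrt hW h.weight).conjTranspose.sub h1).congr ?_
    filter_upwards [hs.sqrt_mul_coIsometry hW] with t ht
    have ht' := congrArg Matrix.conjTranspose ht
    simp only [Matrix.conjTranspose_mul, sqrt_conjTranspose,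
      Matrix.conjTranspose_conjTranspose] at ht' ⊢
    rw [← Matrix.mul_assoc _ (CFC.sqrt _), ht', Matrix.mul_sub, Matrix.mul_assoc]
  memGQ := by
    have h1 : MemLpLoc ⊤ fun t => (coIsometry ι₂ W t)ᴴ * (CFC.sqrt (ι₂ᴴ * W t * ι₂) *
        (ι₂ᴴ * K t * ι₂)⁻¹ * CFC.sqrt (ι₂ᴴ * W t * ι₂) * coIsometry ι₂ W t) :=
      (hs.memLpLoc_coIsometry hW).conjTranspose.mul
        (MemLpLoc.mul (r := ⊤) h.center (hs.memLpLoc_coIsometry hW))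
    refine h1.congr ?_
    filter_upwards [hs.sqrt_mul_coIsometry hW] with t ht
    have ht' := congrArg Matrix.conjTranspose ht
    simp only [Matrix.conjTranspose_mul, sqrt_conjTranspose,
      Matrix.conjTranspose_conjTranspose] at ht' ⊢
    rw [Matrix.mul_assoc _ (CFC.sqrt _), ht, Matrix.mul_assoc (CFC.sqrt _), ← Matrix.mul_assoc,
      ht', Matrix.mul_assoc]
  measP := (measMat_const ι).sub ((measMat_const ι₂).mul
    ((((measMat_const ι₂ᴴ).mul hK).mul (measMat_const ι₂)).inv.mul
      (((measMat_const ι₂ᴴ).mul hK).mul (measMat_const ι))))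
  measQ := (measMat_const ι₂).mul
    ((((measMat_const ι₂ᴴ).mul hK).mul (measMat_const ι₂)).inv.mul
      ((measMat_const ι₂ᴴ).mul (hW.meas.sqrt hW.posSemidef)))
  mul_P t := by
    rw [Matrix.mul_sub, hs.h11, ← Matrix.mul_assoc, hs.h12, Matrix.zero_mul, sub_zero]
  mul_Q t := by
    rw [← Matrix.mul_assoc, hs.h12, Matrix.zero_mul]
  solve := by
    filter_upwards [h.det] with t ht x y' κ
    exact hs.solve_iff hJ₁ (isUnit_iff_ne_zero.2 ht) x y' κ

/-- An invertible `J` is adapted with an empty second block; the block conditions then reduce to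
the local integrability of the coefficients. -/
lemma LocalIndexOne.exists_blocks {J : Matrix (Fin n) (Fin n) ℂ} (h : LocalIndexOne J K W) :
    ∃ (n₁ n₂ : ℕ) (V : Matrix (Fin n) (Fin n₁ ⊕ Fin n₂) ℂ), IsAdapted J V ∧
    BlockIndexOne
      (fun t => (Vᴴ * K t * V).toBlocks₁₁) (fun t => (Vᴴ * W t * V).toBlocks₁₁)
      (fun t => (Vᴴ * K t * V).toBlocks₁₂) (fun t => (Vᴴ * W t * V).toBlocks₁₂)
      (fun t => (Vᴴ * K t * V).toBlocks₂₁) (fun t => (Vᴴ * W t * V).toBlocks₂₁)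
      (fun t => (Vᴴ * K t * V).toBlocks₂₂) (fun t => (Vᴴ * W t * V).toBlocks₂₂) := by
  by_cases hJ : J.det = 0
  · exact h.2 hJ
  obtain ⟨hK, hW⟩ := h.1 hJ
  let V : Matrix (Fin n) (Fin n ⊕ Fin 0) ℂ :=
    (1 : Matrix (Fin n) (Fin n) ℂ).submatrix id (Equiv.sumEmpty (Fin n) (Fin 0))
  have hV : ∀ M : Matrix (Fin n) (Fin n) ℂ, Vᴴ * M * V =
      M.submatrix (Equiv.sumEmpty (Fin n) (Fin 0)) (Equiv.sumEmpty (Fin n) (Fin 0)) := by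
    intro M
    ext i j
    simp [V, Matrix.mul_apply, Matrix.one_apply, apply_ite]
  have h11 : ∀ M : Matrix (Fin n) (Fin n) ℂ, (Vᴴ * M * V).toBlocks₁₁ = M := fun M => by
    rw [hV]; rfl
  refine ⟨n, 0, V, ⟨?_, ?_, J, hJ, ?_⟩, ?_⟩
  · have := hV 1
    rw [Matrix.mul_one] at this
    rw [this, Matrix.submatrix_one_equiv]
  · simp only [V]
    rw [Matrix.conjTranspose_submatrix, Matrix.conjTranspose_one, Matrix.submatrix_mul_equiv,
      Matrix.mul_one, Matrix.submatrix_id_id]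
  · rw [hV]
    ext i j
    rcases i with i | i
    · rcases j with j | j
      · rfl
      · exact j.elim0
    · exact i.elim0
  · have hE : ∀ (p : ENNReal) {m : ℕ} (M : ℝ → Matrix (Fin m) (Fin 0) ℂ), MemLpLoc p M :=
      fun p _ M _ j => j.elim0
    refine ⟨?_, fun i => i.elim0, hE _ _, ?_, ?_, hE _ _, fun i => i.elim0, ?_⟩
    · simp
    · refine hK.congr (Filter.Eventually.of_forall fun t => ?_)
      rw [h11]; ext i j; simp
    · refine hW.congr (Filter.Eventually.of_forall fun t => ?_)
      rw [h11]
    · refine hW.congr (Filter.Eventually.of_forall fun t => ?_)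
      rw [h11]; ext i j; simp

lemma IsAdapted.isSplit {J : Matrix (Fin n) (Fin n) ℂ}
    {V : Matrix (Fin n) (Fin m ⊕ Fin m₂) ℂ} (h : IsAdapted J V) :
    IsSplit V.toCols₁ V.toCols₂ where
  h11 := by
    have := congrArg Matrix.toBlocks₁₁ h.conjTranspose_mul_self
    rw [← Matrix.fromBlocks_one, Matrix.toBlocks_fromBlocks₁₁] at this
    exact this
  h22 := by
    have := congrArg Matrix.toBlocks₂₂ h.conjTranspose_mul_self
    rw [← Matrix.fromBlocks_one, Matrix.toBlocks_fromBlocks₂₂] at this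
    exact this
  h12 := by
    have := congrArg Matrix.toBlocks₁₂ h.conjTranspose_mul_self
    rw [← Matrix.fromBlocks_one, Matrix.toBlocks_fromBlocks₁₂] at this
    exact this
  h21 := by
    have := congrArg Matrix.toBlocks₂₁ h.conjTranspose_mul_self
    rw [← Matrix.fromBlocks_one, Matrix.toBlocks_fromBlocks₂₁] at this
    exact this
  sum := by
    rw [← h.mul_conjTranspose_self]
    ext i j
    simp [Matrix.mul_apply, Matrix.toCols₁, Matrix.toCols₂]

lemma IsAdapted.exists_eq {J : Matrix (Fin n) (Fin n) ℂ}
    {V : Matrix (Fin n) (Fin m ⊕ Fin m₂) ℂ} (h : IsAdapted J V) :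
    ∃ J₁ : Matrix (Fin m) (Fin m) ℂ, IsUnit J₁.det ∧ J = V.toCols₁ * J₁ * V.toCols₁ᴴ := by
  obtain ⟨J₁, h1, h2⟩ := h.block_form
  refine ⟨J₁, isUnit_iff_ne_zero.2 h1, ?_⟩
  have h3 : J = V * (Vᴴ * J * V) * Vᴴ := by
    rw [← Matrix.mul_assoc, ← Matrix.mul_assoc, h.mul_conjTranspose_self, Matrix.one_mul,
      Matrix.mul_assoc, h.mul_conjTranspose_self, Matrix.mul_one]
  rw [h2] at h3
  nth_rw 1 [h3]
  ext i j
  simp [Matrix.mul_apply, Matrix.toCols₁]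

end Reduction

/-! ### Solutions of the reduced system -/

section Solutions

variable {n m : ℕ}

/-- The vector function `κ` has entries in `L^p_loc(ℝ)`. -/
def MemLpLocVec (p : ENNReal) (κ : ℝ → Fin n → ℂ) : Prop :=
  MemLpLoc p fun t => Matrix.replicateCol Unit (κ t)

lemma MemLpLoc.mulVec {p q r : ENNReal} [ENNReal.HolderTriple p q r]
    {A : ℝ → Matrix (Fin m) (Fin n) ℂ} {κ : ℝ → Fin n → ℂ} (hA : MemLpLoc p A)
    (hκ : MemLpLocVec q κ) : MemLpLocVec r fun t => A t *ᵥ κ t := by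
  have h : MemLpLoc r fun t => A t * Matrix.replicateCol Unit (κ t) := MemLpLoc.mul hA hκ
  simpa only [MemLpLocVec, Matrix.replicateCol_mulVec] using h

lemma MemLpLocVec.add {p : ENNReal} {κ κ' : ℝ → Fin n → ℂ} (h : MemLpLocVec p κ)
    (h' : MemLpLocVec p κ') : MemLpLocVec p fun t => κ t + κ' t := fun i j a b =>
  (h i j a b).add (h' i j a b)

lemma MemLpLocVec.sub {p : ENNReal} {κ κ' : ℝ → Fin n → ℂ} (h : MemLpLocVec p κ)
    (h' : MemLpLocVec p κ') : MemLpLocVec p fun t => κ t - κ' t := fun i j a b =>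
  (h i j a b).sub (h' i j a b)

lemma memLpLocVec_zero {p : ENNReal} : MemLpLocVec p fun _ => (0 : Fin n → ℂ) :=
  fun _ _ _ _ => MemLp.zero

lemma memLpLocVec_top_of_continuous {y : ℝ → Fin n → ℂ} (hy : Continuous y) :
    MemLpLocVec ⊤ y := fun i _ a b => by
  have hc : Continuous fun t => y t i := (continuous_apply i).comp hy
  obtain ⟨C, hC⟩ := isCompact_Icc.exists_bound_of_continuousOn (s := Set.Icc a b) hc.continuousOn
  exact memLp_top_of_bound hc.aestronglyMeasurable C
    (ae_restrict_of_forall_mem measurableSet_Icc hC)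

lemma locallyIntegrable_of_memLp {f : ℝ → ℂ}
    (h : ∀ a b, MemLp f 1 (volume.restrict (Set.Icc a b))) : LocallyIntegrable f volume :=
  fun x => ⟨Set.Icc (x - 1) (x + 1), Icc_mem_nhds (by linarith) (by linarith),
    memLp_one_iff_integrable.1 (h _ _)⟩

lemma MemLpLocVec.locallyIntegrable_dotProduct {κ κ' : ℝ → Fin n → ℂ} (h : MemLpLocVec 2 κ)
    (h' : MemLpLocVec 2 κ') : LocallyIntegrable (fun t => star (κ t) ⬝ᵥ κ' t) volume := by
  refine locallyIntegrable_of_memLp fun a b => ?_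
  simp only [dotProduct]
  exact memLp_finsetSum _ fun i _ => (h' i () a b).mul (h i () a b).star

lemma locallyIntegrable_finset_sum {ι E : Type*} [NormedAddCommGroup E] (s : Finset ι)
    {f : ι → ℝ → E} (h : ∀ i ∈ s, LocallyIntegrable (f i) volume) :
    LocallyIntegrable (fun t => ∑ i ∈ s, f i t) volume := by
  classical
  induction s using Finset.induction_on with
  | empty => simpa only [Finset.sum_empty] using locallyIntegrable_const (0 : E)
  | insert i s hi ih =>
    simp only [Finset.sum_insert hi]
    exact (h i (Finset.mem_insert_self _ _)).add
      (ih fun j hj => h j (Finset.mem_insert_of_mem hj))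

lemma norm_mulVec_le_sum (M : Matrix (Fin m) (Fin n) ℂ) (x : Fin n → ℂ) :
    ‖M *ᵥ x‖ ≤ (∑ i, ∑ j, ‖M i j‖) * ‖x‖ := by
  have h0 : ∀ i, 0 ≤ ∑ j, ‖M i j‖ := fun i => Finset.sum_nonneg fun _ _ => norm_nonneg _
  refine (pi_norm_le_iff_of_nonneg
    (mul_nonneg (Finset.sum_nonneg fun i _ => h0 i) (norm_nonneg _))).2 fun i => ?_
  calc ‖(M *ᵥ x) i‖ ≤ ∑ j, ‖M i j * x j‖ := norm_sum_le Finset.univ fun j => M i j * x j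
    _ ≤ ∑ j, ‖M i j‖ * ‖x‖ := Finset.sum_le_sum fun j _ => by
        rw [norm_mul]; exact mul_le_mul_of_nonneg_left (norm_le_pi_norm x j) (norm_nonneg _)
    _ = (∑ j, ‖M i j‖) * ‖x‖ := by rw [Finset.sum_mul]
    _ ≤ _ := mul_le_mul_of_nonneg_right
        (Finset.single_le_sum (f := fun i => ∑ j, ‖M i j‖) (fun i _ => h0 i)
          (Finset.mem_univ i)) (norm_nonneg _)

namespace ReducedSystem

variable {ι : Matrix (Fin n) (Fin m) ℂ} {J₁ : Matrix (Fin m) (Fin m) ℂ}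
  {K K' W : ℝ → Matrix (Fin n) (Fin n) ℂ} (S : ReducedSystem ι J₁ K W)
  (S' : ReducedSystem ι J₁ K' W)

/-- The right-hand side of the reduced equation `y' = A y + B κ`. -/
def rhs (κ : ℝ → Fin n → ℂ) (t : ℝ) (y : Fin m → ℂ) : Fin m → ℂ := S.A t *ᵥ y + S.B t *ᵥ κ t

/-- `y` solves `y' = A y + B κ` on `ℝ` in the sense of Carathéodory. -/
def IsSolution (κ : ℝ → Fin n → ℂ) (y : ℝ → Fin m → ℂ) : Prop :=
  Continuous y ∧ ∀ t, y t = y 0 + ∫ s in (0 : ℝ)..t, S.rhs κ s (y s)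

/-- The full unknown `x = P y + Q κ`. -/
def state (κ : ℝ → Fin n → ℂ) (y : ℝ → Fin m → ℂ) (t : ℝ) : Fin n → ℂ :=
  S.P t *ᵥ y t + S.Q t *ᵥ κ t

variable {S S'} {κ κ' : ℝ → Fin n → ℂ} {y y' : ℝ → Fin m → ℂ}

lemma exists_isCaratheodory (hκ : MemLpLocVec 2 κ) : ∃ β, IsCaratheodory (S.rhs κ) β := by
  have hB : MemLpLocVec 1 fun t => S.B t *ᵥ κ t := S.memB.mulVec hκ
  have hA : ∀ i j, LocallyIntegrable (fun t => S.A t i j) volume := fun i j =>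
    locallyIntegrable_of_memLp (S.memA i j)
  have hBi : ∀ i, LocallyIntegrable (fun t => (S.B t *ᵥ κ t) i) volume := fun i =>
    locallyIntegrable_of_memLp (hB i ())
  have h0 : ∀ t, 0 ≤ ∑ i, ∑ j, ‖S.A t i j‖ := fun t =>
    Finset.sum_nonneg fun _ _ => Finset.sum_nonneg fun _ _ => norm_nonneg _
  have h1 : ∀ t, 0 ≤ ∑ i, ‖(S.B t *ᵥ κ t) i‖ := fun t => Finset.sum_nonneg fun _ _ => norm_nonneg _
  refine ⟨fun t => ∑ i, ∑ j, ‖S.A t i j‖ + ∑ i, ‖(S.B t *ᵥ κ t) i‖, ?_,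
    fun t => add_nonneg (h0 t) (h1 t), ?_, ?_, ?_⟩
  · exact (locallyIntegrable_finset_sum _ fun i _ => locallyIntegrable_finset_sum _ fun j _ =>
      fun x => (hA i j x).norm).add (locallyIntegrable_finset_sum _ fun i _ => fun x => (hBi i x).norm)
  · intro y hy
    refine aesm_pi_iff.2 fun i => ?_
    simp only [rhs, Pi.add_apply]
    refine AEMeasurable.add ?_ (hBi i).aestronglyMeasurable.aemeasurable
    simp only [Matrix.mulVec, dotProduct]
    exact Finset.aemeasurable_fun_sum _ fun j _ =>
      (hA i j).aestronglyMeasurable.aemeasurable.mul ((continuous_apply j).comp hy).aemeasurable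
  · intro t x x'
    simp only [rhs, add_sub_add_right_eq_sub, ← Matrix.mulVec_sub]
    refine (norm_mulVec_le_sum _ _).trans (mul_le_mul_of_nonneg_right ?_ (norm_nonneg _))
    linarith [h1 t]
  · intro t
    simp only [rhs, Matrix.mulVec_zero, zero_add]
    refine (pi_norm_le_iff_of_nonneg (add_nonneg (h0 t) (h1 t))).2 fun i => ?_
    have := Finset.single_le_sum (f := fun i => ‖(S.B t *ᵥ κ t) i‖) (fun _ _ => norm_nonneg _)
      (Finset.mem_univ i)
    linarith [h0 t]

lemma IsSolution.locallyIntegrable (hκ : MemLpLocVec 2 κ) (hy : S.IsSolution κ y) :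
    LocallyIntegrable (fun t => S.rhs κ t (y t)) volume := by
  obtain ⟨β, hβ⟩ := S.exists_isCaratheodory hκ
  exact hβ.locallyIntegrable_comp hy.1

lemma IsSolution.eq_add_integral (hκ : MemLpLocVec 2 κ) (hy : S.IsSolution κ y) (a t : ℝ) :
    y t = y a + ∫ s in a..t, S.rhs κ s (y s) := by
  have hi := intervalIntegrable_of_locallyIntegrable (hy.locallyIntegrable hκ)
  rw [hy.2 t, hy.2 a, add_assoc, intervalIntegral.integral_add_adjacent_intervals (hi _ _) (hi _ _)]

lemma isSolution_of_eq_add_integral (hκ : MemLpLocVec 2 κ) (hc : Continuous y) (a : ℝ)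
    (h : ∀ t, y t = y a + ∫ s in a..t, S.rhs κ s (y s)) : S.IsSolution κ y := by
  obtain ⟨β, hβ⟩ := S.exists_isCaratheodory hκ
  have hi := intervalIntegrable_of_locallyIntegrable (hβ.locallyIntegrable_comp hc)
  refine ⟨hc, fun t => ?_⟩
  rw [h t, h 0, add_assoc, intervalIntegral.integral_add_adjacent_intervals (hi _ _) (hi _ _)]

lemma exists_isSolution (hκ : MemLpLocVec 2 κ) (a : ℝ) (c : Fin m → ℂ) :
    ∃ y, S.IsSolution κ y ∧ y a = c := by
  obtain ⟨β, hβ⟩ := S.exists_isCaratheodory hκ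
  obtain ⟨y, hc, hy⟩ := hβ.exists_solution a c
  have ha : y a = c := by rw [hy a]; simp
  exact ⟨y, isSolution_of_eq_add_integral hκ hc a (by rw [ha]; exact hy), ha⟩

lemma IsSolution.eq_of_eq (hκ : MemLpLocVec 2 κ) (hy : S.IsSolution κ y)
    (hy' : S.IsSolution κ y') {a : ℝ} (h : y a = y' a) : y = y' := by
  obtain ⟨β, hβ⟩ := S.exists_isCaratheodory hκ
  funext b
  exact hβ.unique hy.1 hy'.1 h (fun t _ => hy.eq_add_integral hκ a t)
    (fun t _ => hy'.eq_add_integral hκ a t)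

lemma IsSolution.eq_zero (hκ : MemLpLocVec 2 κ) (hy : S.IsSolution κ y) {a b : ℝ}
    (ha : y a = 0) (h : ∀ᵐ t, t ∈ Set.uIcc a b → κ t = 0) : y b = 0 := by
  obtain ⟨β, hβ⟩ := S.exists_isCaratheodory hκ
  refine hβ.unique (z := fun _ => 0) hy.1 continuous_const ha
    (fun t _ => hy.eq_add_integral hκ a t) fun t ht => ?_
  rw [zero_add, eq_comm]
  refine intervalIntegral.integral_zero_ae (h.mono fun s hs hst => ?_)
  rw [rhs, hs (Set.uIcc_subset_uIcc Set.left_mem_uIcc ht (Set.uIoc_subset_uIcc hst))]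
  simp

lemma IsSolution.congr (hy : S.IsSolution κ y) (h : ∀ᵐ t, κ t = κ' t) : S.IsSolution κ' y := by
  refine ⟨hy.1, fun t => ?_⟩
  rw [hy.2 t]
  congr 1
  refine intervalIntegral.integral_congr_ae (h.mono fun s hs _ => ?_)
  simp only [rhs, hs]

lemma IsSolution.add (hκ : MemLpLocVec 2 κ) (hκ' : MemLpLocVec 2 κ') (hy : S.IsSolution κ y)
    (hy' : S.IsSolution κ' y') : S.IsSolution (κ + κ') (y + y') := by
  refine ⟨hy.1.add hy'.1, fun t => ?_⟩
  have h : ∀ s, S.rhs (κ + κ') s ((y + y') s) = S.rhs κ s (y s) + S.rhs κ' s (y' s) := fun s => by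
    simp only [rhs, Pi.add_apply, Matrix.mulVec_add]; abel
  simp only [h]
  rw [intervalIntegral.integral_add
    (intervalIntegrable_of_locallyIntegrable (hy.locallyIntegrable hκ) _ _)
    (intervalIntegrable_of_locallyIntegrable (hy'.locallyIntegrable hκ') _ _),
    Pi.add_apply, Pi.add_apply, hy.2 t, hy'.2 t]
  abel

lemma IsSolution.smul (hy : S.IsSolution κ y) (c : ℂ) : S.IsSolution (c • κ) (c • y) := by
  refine ⟨hy.1.const_smul c, fun t => ?_⟩
  have h : ∀ s, S.rhs (c • κ) s ((c • y) s) = c • S.rhs κ s (y s) := fun s => by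
    simp only [rhs, Pi.smul_apply, Matrix.mulVec_smul, smul_add]
  simp only [h]
  rw [intervalIntegral.integral_smul, Pi.smul_apply, Pi.smul_apply, hy.2 t, smul_add]

lemma isSolution_sum {v : Fin m → ℝ → Fin m → ℂ} (hv : ∀ i, S.IsSolution 0 (v i))
    (c : Fin m → ℂ) (s : Finset (Fin m)) : S.IsSolution 0 (∑ i ∈ s, c i • v i) := by
  induction s using Finset.induction_on with
  | empty =>
    have h := (S.exists_isSolution memLpLocVec_zero 0 0).choose_spec.1.smul (0 : ℂ)
    simpa using h
  | insert i s hi ih =>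
    rw [Finset.sum_insert hi]
    have h := ((hv i).smul (c i)).add (κ' := 0) (by rw [smul_zero]; exact memLpLocVec_zero)
      memLpLocVec_zero ih
    simpa using h

variable (S) in
/-- The solutions of the homogeneous equation are spanned by those with initial values the unit
vectors. -/
lemma exists_fundamental : ∃ v : Fin m → ℝ → Fin m → ℂ, (∀ i, S.IsSolution 0 (v i)) ∧
    ∀ w, S.IsSolution 0 w → w = ∑ i, w 0 i • v i := by
  choose v hv hv0 using fun i : Fin m =>
    S.exists_isSolution (κ := 0) memLpLocVec_zero 0 (Pi.single i 1)
  refine ⟨v, hv, fun w hw => ?_⟩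
  refine hw.eq_of_eq memLpLocVec_zero (isSolution_sum hv _ _) (a := 0) ?_
  ext j
  simp [Finset.sum_apply, hv0, Pi.single_apply]

lemma IsSolution.isLocAC (hκ : MemLpLocVec 2 κ) (hy : S.IsSolution κ y) : IsLocAC y :=
  fun a b => by
  refine absolutelyContinuousOnInterval_of_dist_le
    (absolutelyContinuousOnInterval_primitive (hy.locallyIntegrable hκ) 0 a b) fun s t => ?_
  rw [hy.2 s, hy.2 t, dist_add_left]

lemma IsSolution.ae_hasDerivAt (hκ : MemLpLocVec 2 κ) (hy : S.IsSolution κ y) :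
    ∀ᵐ t, HasDerivAt y (S.rhs κ t (y t)) t := by
  filter_upwards [_root_.LocallyIntegrable.ae_hasDerivAt_integral (hy.locallyIntegrable hκ)]
    with t ht
  have h : y = fun t => y 0 + ∫ s in (0 : ℝ)..t, S.rhs κ s (y s) := funext hy.2
  rw [h]
  simpa only [← hy.2] using (ht 0).const_add (y 0)

lemma isSolution_of_isLocAC (hκ : MemLpLocVec 2 κ) (hy : IsLocAC y)
    (h : ∀ᵐ t, deriv y t = S.rhs κ t (y t)) : S.IsSolution κ y := by
  obtain ⟨β, hβ⟩ := S.exists_isCaratheodory hκ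
  refine ⟨hy.continuous, fun t => ?_⟩
  refine eq_add_integral_of_ae_hasDerivAt hy (hβ.locallyIntegrable_comp hy.continuous) ?_ 0 t
  filter_upwards [h, hy.ae_differentiableAt] with t h1 h2
  rw [← h1]; exact h2.hasDerivAt

variable (S) in
lemma conjTranspose_mulVec_state (κ : ℝ → Fin n → ℂ) (y : ℝ → Fin m → ℂ) (t : ℝ) :
    ιᴴ *ᵥ S.state κ y t = y t := by
  rw [state, Matrix.mulVec_add, Matrix.mulVec_mulVec, Matrix.mulVec_mulVec, S.mul_P, S.mul_Q]
  simp

variable (S) in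
lemma memLpLocVec_sqrt_mulVec_state (hκ : MemLpLocVec 2 κ) (hy : Continuous y) :
    MemLpLocVec 2 fun t => CFC.sqrt (W t) *ᵥ S.state κ y t := by
  simp only [state, Matrix.mulVec_add, Matrix.mulVec_mulVec]
  exact (S.memGP.mulVec (memLpLocVec_top_of_continuous hy)).add (S.memGQ.mulVec hκ)

lemma IsSolution.equation (hκ : MemLpLocVec 2 κ) (hy : S.IsSolution κ y) :
    ∀ᵐ t, ι *ᵥ (J₁ *ᵥ deriv y t) + K t *ᵥ S.state κ y t = CFC.sqrt (W t) *ᵥ κ t := by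
  filter_upwards [S.solve, hy.ae_hasDerivAt hκ] with t h1 h2
  rw [h1, S.conjTranspose_mulVec_state, h2.deriv]
  exact ⟨rfl, rfl⟩

end ReducedSystem

/-! ### Lagrange's identity -/

lemma star_mulVec_dotProduct {k l : ℕ} (M : Matrix (Fin k) (Fin l) ℂ) (v : Fin l → ℂ)
    (w : Fin k → ℂ) : star (M *ᵥ v) ⬝ᵥ w = star v ⬝ᵥ (Mᴴ *ᵥ w) := by
  rw [Matrix.star_mulVec, Matrix.dotProduct_mulVec]

lemma IsLocAC.mulVec {k l : ℕ} {y : ℝ → Fin k → ℂ} (hy : IsLocAC y)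
    (M : Matrix (Fin l) (Fin k) ℂ) : IsLocAC fun t => M *ᵥ y t := fun a b => by
  refine absolutelyContinuousOnInterval_of_dist_le
    ((hy.const_smul ((∑ i, ∑ j, ‖M i j‖ : ℝ) : ℂ)) a b) fun s t => ?_
  have h0 : 0 ≤ ∑ i, ∑ j, ‖M i j‖ :=
    Finset.sum_nonneg fun _ _ => Finset.sum_nonneg fun _ _ => norm_nonneg _
  rw [dist_eq_norm, dist_eq_norm, ← Matrix.mulVec_sub, Pi.smul_apply, Pi.smul_apply, ← smul_sub,
    norm_smul, Complex.norm_real, Real.norm_of_nonneg h0]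
  exact norm_mulVec_le_sum _ _

lemma IsLocAC.dotProduct {k : ℕ} {y z : ℝ → Fin k → ℂ} (hy : IsLocAC y) (hz : IsLocAC z)
    (a b : ℝ) : AbsolutelyContinuousOnInterval (fun t => star (y t) ⬝ᵥ z t) a b := by
  have hterm : ∀ i, AbsolutelyContinuousOnInterval (fun t => star (y t i) • z t i) a b := by
    intro i
    refine AbsolutelyContinuousOnInterval.fun_smul (M := ℂ) (F := ℂ)
      (absolutelyContinuousOnInterval_of_dist_le (hy a b) fun s t => ?_)
      (absolutelyContinuousOnInterval_of_dist_le (hz a b) fun s t => ?_)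
    · rw [dist_eq_norm, ← star_sub, norm_star, ← dist_eq_norm]
      exact dist_le_pi_dist _ _ i
    · exact dist_le_pi_dist _ _ i
  have hsum : ∀ s : Finset (Fin k),
      AbsolutelyContinuousOnInterval (fun t => ∑ i ∈ s, star (y t i) • z t i) a b := by
    intro s
    induction s using Finset.induction_on with
    | empty =>
      simpa using
        (LipschitzWith.const (0 : ℂ)).lipschitzOnWith.absolutelyContinuousOnInterval (a := a) (b := b)
    | insert i s hi ih =>
      simp only [Finset.sum_insert hi]
      exact (hterm i).fun_add ih
  exact hsum Finset.univ

lemma hasDerivAt_dotProduct {k : ℕ} {y z : ℝ → Fin k → ℂ} {u v : Fin k → ℂ} {t : ℝ}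
    (hy : HasDerivAt y u t) (hz : HasDerivAt z v t) :
    HasDerivAt (fun t => star (y t) ⬝ᵥ z t) (star u ⬝ᵥ z t + star (y t) ⬝ᵥ v) t := by
  rw [hasDerivAt_pi] at hy hz
  simp only [dotProduct, ← Finset.sum_add_distrib]
  exact HasDerivAt.fun_sum fun i _ => (hy i).star.mul (hz i)

lemma hasDerivAt_mulVec {k l : ℕ} (M : Matrix (Fin l) (Fin k) ℂ) {y : ℝ → Fin k → ℂ}
    {u : Fin k → ℂ} {t : ℝ} (hy : HasDerivAt y u t) :
    HasDerivAt (fun t => M *ᵥ y t) (M *ᵥ u) t := by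
  rw [hasDerivAt_pi] at hy ⊢
  intro i
  simp only [Matrix.mulVec, dotProduct]
  exact HasDerivAt.fun_sum fun j _ => (hy j).const_mul (M i j)

namespace ReducedSystem

variable {ι : Matrix (Fin n) (Fin m) ℂ} {J₁ : Matrix (Fin m) (Fin m) ℂ}
  {K K' W : ℝ → Matrix (Fin n) (Fin n) ℂ} {S : ReducedSystem ι J₁ K W}
  {S' : ReducedSystem ι J₁ K' W} {κ κ' : ℝ → Fin n → ℂ} {y y' : ℝ → Fin m → ℂ}

/-- Lagrange's identity for the equations with the coefficients `K` and `Kᴴ`. -/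
lemma integral_lagrange (hJ₁ : J₁ᴴ = -J₁) (hK : ∀ᵐ t, K' t = (K t)ᴴ) (hκ : MemLpLocVec 2 κ)
    (hκ' : MemLpLocVec 2 κ') (hy : S.IsSolution κ y) (hy' : S'.IsSolution κ' y') (a b : ℝ) :
    ∫ t in a..b, (star (κ t) ⬝ᵥ (CFC.sqrt (W t) *ᵥ S'.state κ' y' t) -
      star (CFC.sqrt (W t) *ᵥ S.state κ y t) ⬝ᵥ κ' t) =
    star (y a) ⬝ᵥ (J₁ *ᵥ y' a) - star (y b) ⬝ᵥ (J₁ *ᵥ y' b) := by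
  have hint := ((hκ.locallyIntegrable_dotProduct (S'.memLpLocVec_sqrt_mulVec_state hκ' hy'.1)).sub
    ((S.memLpLocVec_sqrt_mulVec_state hκ hy.1).locallyIntegrable_dotProduct hκ')).neg
  have h := eq_add_integral_of_ae_hasDerivAt
    ((hy.isLocAC hκ).dotProduct ((hy'.isLocAC hκ').mulVec J₁)) hint ?_ a b
  · simp only [Pi.neg_apply, Pi.sub_apply, intervalIntegral.integral_neg] at h
    rw [h]; ring
  filter_upwards [hy.equation hκ, hy'.equation hκ', hy.ae_hasDerivAt hκ, hy'.ae_hasDerivAt hκ', hK]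
    with t h1 h2 h3 h4 h5
  refine (hasDerivAt_dotProduct h3 (hasDerivAt_mulVec J₁ h4)).congr_deriv ?_
  rw [h3.deriv] at h1
  rw [h4.deriv, h5] at h2
  have e1 : star (κ t) ⬝ᵥ (CFC.sqrt (W t) *ᵥ S'.state κ' y' t) =
      -(star (S.rhs κ t (y t)) ⬝ᵥ (J₁ *ᵥ y' t)) +
        star (S.state κ y t) ⬝ᵥ ((K t)ᴴ *ᵥ S'.state κ' y' t) := by
    nth_rw 1 [← sqrt_conjTranspose (W t)]
    rw [← star_mulVec_dotProduct, ← h1, star_add, add_dotProduct, star_mulVec_dotProduct,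
      star_mulVec_dotProduct, star_mulVec_dotProduct, S'.conjTranspose_mulVec_state, hJ₁,
      Matrix.neg_mulVec, dotProduct_neg]
  have e2 : star (CFC.sqrt (W t) *ᵥ S.state κ y t) ⬝ᵥ κ' t =
      star (y t) ⬝ᵥ (J₁ *ᵥ S'.rhs κ' t (y' t)) +
        star (S.state κ y t) ⬝ᵥ ((K t)ᴴ *ᵥ S'.state κ' y' t) := by
    rw [star_mulVec_dotProduct, sqrt_conjTranspose, ← h2, dotProduct_add]
    congr 1
    rw [← S.conjTranspose_mulVec_state κ y t, star_mulVec_dotProduct,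
      Matrix.conjTranspose_conjTranspose]
  simp only [Pi.neg_apply, Pi.sub_apply]
  rw [e1, e2]; ring

end ReducedSystem

end Solutions

/-! ### The weighted space in terms of `W^{1/2} f` -/

section Weighted

variable {n : ℕ} {W : ℝ → Matrix (Fin n) (Fin n) ℂ} {hW : IsWeight W}

/-- A representative of `W^{1/2} f`. -/
def sqrtRep (f : WeightedL2 hW) (t : ℝ) : Fin n → ℂ := CFC.sqrt (W t) *ᵥ WeightedL2.incl hW f t

lemma memLp_sqrtRep (f : WeightedL2 hW) (i : Fin n) :
    MemLp (fun t => sqrtRep f t i) 2 volume := by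
  refine (WeightedL2.memLp f).mono ?_ (Filter.Eventually.of_forall fun t => ?_)
  · exact (aesm_pi_iff.1 ((hW.meas.sqrt hW.posSemidef).mulVec
      (AEEqFun.aestronglyMeasurable _)) i).aestronglyMeasurable
  · exact PiLp.norm_apply_le (sqrtMul W (WeightedL2.incl hW f) t) i

lemma memLpLocVec_sqrtRep (f : WeightedL2 hW) : MemLpLocVec 2 (sqrtRep f) :=
  fun i _ _ _ => (memLp_sqrtRep f i).restrict _

lemma exists_sqrtRep_eq (hW : IsWeight W) {κ : ℝ → Fin n → ℂ}
    (hκ : ∀ i, MemLp (fun t => κ t i) 2 volume) :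
    ∃ f : WeightedL2 hW, ∀ᵐ t, sqrtRep f t = κ t := by
  have h : MemLp (fun t => (WithLp.toLp 2 (κ t) : EuclideanSpace ℂ (Fin n))) 2 volume :=
    MemLp.of_eval_piLp hκ
  obtain ⟨f, hf⟩ := (WeightedL2.toL2_bijective (hW := hW)).2 (h.toLp _)
  refine ⟨f, ?_⟩
  have h1 := WeightedL2.coeFn_toL2 f
  rw [hf] at h1
  filter_upwards [h1, h.coeFn_toLp] with t h2 h3
  rw [h3] at h2
  exact (WithLp.toLp_injective 2 h2).symm

lemma integrable_dotProduct {κ κ' : ℝ → Fin n → ℂ} (h : ∀ i, MemLp (fun t => κ t i) 2 volume)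
    (h' : ∀ i, MemLp (fun t => κ' t i) 2 volume) :
    Integrable (fun t => star (κ t) ⬝ᵥ κ' t) volume := by
  rw [← memLp_one_iff_integrable]
  simp only [dotProduct]
  exact memLp_finsetSum _ fun i _ => (h' i).mul (h i).star

lemma inner_eq_integral_sqrtRep (f g : WeightedL2 hW) :
    inner ℂ f g = ∫ t, star (sqrtRep f t) ⬝ᵥ sqrtRep g t := by
  rw [WeightedL2.inner_def]
  refine integral_congr_ae ?_
  filter_upwards [hW.sqrt_mul_self] with t ht
  rw [sqrtRep, sqrtRep]
  nth_rw 1 [← ht]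
  rw [← Matrix.mulVec_mulVec, star_mulVec_dotProduct, sqrt_conjTranspose]

lemma sqrtRep_add (f g : WeightedL2 hW) :
    ∀ᵐ t, sqrtRep (f + g) t = sqrtRep f t + sqrtRep g t := by
  filter_upwards [AEEqFun.coeFn_add (WeightedL2.incl hW f) (WeightedL2.incl hW g)] with t ht
  rw [sqrtRep, map_add, ht, Pi.add_apply, Matrix.mulVec_add]; rfl

lemma sqrtRep_smul (c : ℂ) (f : WeightedL2 hW) :
    ∀ᵐ t, sqrtRep (c • f) t = c • sqrtRep f t := by
  filter_upwards [AEEqFun.coeFn_smul c (WeightedL2.incl hW f)] with t ht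
  rw [sqrtRep, map_smul, ht, Pi.smul_apply, Matrix.mulVec_smul]; rfl

lemma sqrtRep_sub (f g : WeightedL2 hW) :
    ∀ᵐ t, sqrtRep (f - g) t = sqrtRep f t - sqrtRep g t := by
  filter_upwards [AEEqFun.coeFn_sub (WeightedL2.incl hW f) (WeightedL2.incl hW g)] with t ht
  rw [sqrtRep, map_sub, ht, Pi.sub_apply, Matrix.mulVec_sub]; rfl

lemma sqrtRep_sum {k : ℕ} (c : Fin k → ℂ) (f : Fin k → WeightedL2 hW) :
    ∀ᵐ t, sqrtRep (∑ i, c i • f i) t = ∑ i, c i • sqrtRep (f i) t := by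
  have h : ∀ s : Finset (Fin k),
      ∀ᵐ t, sqrtRep (∑ i ∈ s, c i • f i) t = ∑ i ∈ s, c i • sqrtRep (f i) t := by
    intro s
    induction s using Finset.induction_on with
    | empty =>
      filter_upwards [sqrtRep_smul (0 : ℂ) (0 : WeightedL2 hW)] with t ht
      simpa using ht
    | insert i s hi ih =>
      simp only [Finset.sum_insert hi]
      filter_upwards [ih, sqrtRep_add (c i • f i) (∑ i ∈ s, c i • f i), sqrtRep_smul (c i) (f i)]
        with t h1 h2 h3
      rw [h2, h3, h1]
  exact h Finset.univ

lemma sqrt_mulVec_injective (hW : IsWeight W) :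
    ∀ᵐ t, Function.Injective fun x => CFC.sqrt (W t) *ᵥ x := by
  filter_upwards [WeightedL2.sqrt_det_ne_zero hW] with t ht
  exact Matrix.mulVec_injective_of_isUnit ((Matrix.isUnit_iff_isUnit_det _).2 ht)

lemma eq_of_sqrtRep_eq {f g : WeightedL2 hW} (h : ∀ᵐ t, sqrtRep f t = sqrtRep g t) : f = g := by
  refine WeightedL2.incl_injective (AEEqFun.ext ?_)
  filter_upwards [h, sqrt_mulVec_injective hW] with t h1 h2
  exact h2 h1

end Weighted

/-! ### The graphs of the maximal and minimal operators -/

section Graphs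

variable {n m : ℕ} {J : Matrix (Fin n) (Fin n) ℂ} {H W : ℝ → Matrix (Fin n) (Fin n) ℂ}
  {hH : MeasMat H} {hW : IsWeight W}

lemma mem_graph_maximalOp {f h : WeightedL2 hW} :
    (f, h) ∈ (maximalOp J hH hW).graph ↔ ∃ u, IsACRep J (WeightedL2.incl hW f) u ∧
      ∀ᵐ t, deriv u t + H t *ᵥ WeightedL2.incl hW f t = W t *ᵥ WeightedL2.incl hW h t := by
  rw [LinearPMap.mem_graph_iff]
  constructor
  · rintro ⟨⟨f', hf'⟩, rfl, h2⟩
    obtain ⟨⟨u, hu⟩, -⟩ := id hf'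
    refine ⟨u, hu, ?_⟩
    have h3 := incl_maximalOp (hH := hH) ⟨f', hf'⟩ ⟨u, hu⟩
    simp only at h2
    rw [h2] at h3
    have h4 := daOp_apply (hH := hH) (hW := hW) ⟨WeightedL2.incl hW f', ⟨u, hu⟩⟩ hu
    rw [← h3] at h4
    filter_upwards [h4, hW.det_ne_zero] with t h5 h6
    rw [h5, Matrix.mulVec_mulVec, Matrix.mul_nonsing_inv _ (isUnit_iff_ne_zero.2 h6),
      Matrix.one_mulVec]
  · rintro ⟨u, hu, h1⟩
    have hd : WeightedL2.incl hW f ∈ (daOp J hH hW).domain := ⟨u, hu⟩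
    have h2 : daOp J hH hW ⟨WeightedL2.incl hW f, hd⟩ = WeightedL2.incl hW h := by
      refine AEEqFun.ext ?_
      filter_upwards [daOp_apply (hH := hH) (hW := hW) ⟨_, hd⟩ hu, h1, hW.det_ne_zero]
        with t h3 h4 h5
      rw [h3, h4, Matrix.mulVec_mulVec, Matrix.nonsing_inv_mul _ (isUnit_iff_ne_zero.2 h5),
        Matrix.one_mulVec]
    have hm : f ∈ (maximalOp J hH hW).domain := ⟨hd, by rw [h2]; exact WeightedL2.incl_mem h⟩
    have h3 : maximalOp J hH hW ⟨f, hm⟩ = h :=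
      WeightedL2.incl_injective ((incl_maximalOp ⟨f, hm⟩ hd).trans h2)
    exact ⟨⟨f, hm⟩, rfl, h3⟩

lemma mem_graph_minimalOp {f h : WeightedL2 hW} :
    (f, h) ∈ (minimalOp J hH hW).graph ↔ (f, h) ∈ (maximalOp J hH hW).graph ∧
      ∃ u, IsACRep J (WeightedL2.incl hW f) u ∧ HasCompactSupport u := by
  simp only [LinearPMap.mem_graph_iff]
  constructor
  · rintro ⟨⟨f', hf'⟩, rfl, h2⟩
    rw [minimalOp, LinearPMap.domRestrict_domain] at hf'
    exact ⟨⟨⟨f', hf'.2⟩, rfl, h2⟩, hf'.1⟩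
  · rintro ⟨⟨⟨f', hf'⟩, rfl, h2⟩, h3⟩
    refine ⟨⟨f', ?_⟩, rfl, h2⟩
    rw [minimalOp, LinearPMap.domRestrict_domain]
    exact ⟨h3, hf'⟩

variable {ι : Matrix (Fin n) (Fin m) ℂ} {J₁ : Matrix (Fin m) (Fin m) ℂ} {z : ℂ}

lemma isACRep_iff (hι : ιᴴ * ι = 1) (hJ₁ : IsUnit J₁.det) (hJ : J = ι * J₁ * ιᴴ) {f : MeasFun n}
    {u : ℝ → Fin n → ℂ} : IsACRep J f u ↔ ∃ y : ℝ → Fin m → ℂ, IsLocAC y ∧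
      (∀ᵐ t, y t = ιᴴ *ᵥ f t) ∧ ∀ t, u t = ι *ᵥ (J₁ *ᵥ y t) := by
  constructor
  · rintro ⟨hu, hf⟩
    have hy : IsLocAC fun t => (J₁⁻¹ * ιᴴ) *ᵥ u t := hu.mulVec _
    have hae : ∀ᵐ t, (J₁⁻¹ * ιᴴ) *ᵥ u t = ιᴴ *ᵥ f t := by
      filter_upwards [hf] with t ht
      rw [ht, hJ, Matrix.mulVec_mulVec, Matrix.mul_assoc, Matrix.mul_assoc ι,
        ← Matrix.mul_assoc ιᴴ, hι, Matrix.one_mul, Matrix.nonsing_inv_mul_cancel_left _ _ hJ₁]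
    refine ⟨_, hy, hae, fun t => ?_⟩
    have h2 : u = fun t => ι *ᵥ (J₁ *ᵥ ((J₁⁻¹ * ιᴴ) *ᵥ u t)) := by
      refine (Continuous.ae_eq_iff_eq volume hu.continuous
        ((hy.mulVec J₁).mulVec ι).continuous).1 ?_
      filter_upwards [hf, hae] with t h3 h4
      rw [h4, h3, hJ]
      simp only [Matrix.mulVec_mulVec, Matrix.mul_assoc]
    exact congrFun h2 t
  · rintro ⟨y, hy, h1, h2⟩
    obtain rfl : u = fun t => ι *ᵥ (J₁ *ᵥ y t) := funext h2
    refine ⟨(hy.mulVec J₁).mulVec ι, ?_⟩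
    filter_upwards [h1] with t ht
    rw [ht, hJ]
    simp only [Matrix.mulVec_mulVec, Matrix.mul_assoc]

lemma sub_smul_mulVec_iff {k w : Matrix (Fin n) (Fin n) ℂ} {a b c s : Fin n → ℂ}
    (h : s = w *ᵥ (b - z • c)) :
    a + k *ᵥ c = w *ᵥ b ↔ a + (k - z • w) *ᵥ c = s := by
  rw [h, Matrix.sub_mulVec, Matrix.mulVec_sub, Matrix.smul_mulVec, Matrix.mulVec_smul,
    ← add_sub_assoc, sub_left_inj]

/-- The graph of the maximal operator, described by the reduced system of `H - z W`. -/
lemma mem_graph_maximalOp_iff (hι : ιᴴ * ι = 1) (hJ₁ : IsUnit J₁.det) (hJ : J = ι * J₁ * ιᴴ)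
    (S : ReducedSystem ι J₁ (fun t => H t - z • W t) W) {f h : WeightedL2 hW} :
    (f, h) ∈ (maximalOp J hH hW).graph ↔ ∃ y, S.IsSolution (sqrtRep (h - z • f)) y ∧
      ∀ᵐ t, WeightedL2.incl hW f t = S.state (sqrtRep (h - z • f)) y t := by
  have hκ := memLpLocVec_sqrtRep (h - z • f)
  have heq : ∀ᵐ t, CFC.sqrt (W t) *ᵥ sqrtRep (h - z • f) t =
      W t *ᵥ (WeightedL2.incl hW h t - z • WeightedL2.incl hW f t) := by
    filter_upwards [hW.sqrt_mul_self, sqrtRep_sub h (z • f), sqrtRep_smul z f] with t h1 h2 h3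
    rw [h2, h3, sqrtRep, sqrtRep, ← Matrix.mulVec_smul, ← Matrix.mulVec_sub, Matrix.mulVec_mulVec,
      h1]
  have hderiv : ∀ {y : ℝ → Fin m → ℂ}, IsLocAC y →
      ∀ᵐ t, deriv (fun t => ι *ᵥ (J₁ *ᵥ y t)) t = ι *ᵥ (J₁ *ᵥ deriv y t) := fun {y} hy => by
    filter_upwards [hy.ae_differentiableAt] with t ht
    exact (hasDerivAt_mulVec ι (hasDerivAt_mulVec J₁ ht.hasDerivAt)).deriv
  rw [mem_graph_maximalOp]
  constructor
  · rintro ⟨u, hu, h1⟩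
    obtain ⟨y, hy, h2, h3⟩ := (isACRep_iff hι hJ₁ hJ).1 hu
    obtain rfl : u = fun t => ι *ᵥ (J₁ *ᵥ y t) := funext h3
    have h4 : ∀ᵐ t, WeightedL2.incl hW f t = S.state (sqrtRep (h - z • f)) y t ∧
        deriv y t = S.rhs (sqrtRep (h - z • f)) t (y t) := by
      filter_upwards [h1, h2, heq, hderiv hy, S.solve] with t e1 e2 e3 e4 e5
      rw [e4, sub_smul_mulVec_iff e3, e5, ← e2] at e1
      exact e1
    exact ⟨y, ReducedSystem.isSolution_of_isLocAC hκ hy (h4.mono fun _ h => h.2),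
      h4.mono fun _ h => h.1⟩
  · rintro ⟨y, hy, h1⟩
    have hac := hy.isLocAC hκ
    refine ⟨_, (isACRep_iff hι hJ₁ hJ).2 ⟨y, hac, ?_, fun _ => rfl⟩, ?_⟩
    · filter_upwards [h1] with t ht
      rw [ht, S.conjTranspose_mulVec_state]
    · filter_upwards [h1, heq, hderiv hac, hy.equation hκ] with t e1 e2 e3 e4
      rw [e3, sub_smul_mulVec_iff e2, e1, e4]

lemma exists_isSolution_of_mem_graph_minimalOp (hι : ιᴴ * ι = 1) (hJ₁ : IsUnit J₁.det)
    (hJ : J = ι * J₁ * ιᴴ) (S : ReducedSystem ι J₁ (fun t => H t - z • W t) W)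
    {f h : WeightedL2 hW} (hf : (f, h) ∈ (minimalOp J hH hW).graph) :
    ∃ y, S.IsSolution (sqrtRep (h - z • f)) y ∧ HasCompactSupport y ∧
      ∀ᵐ t, WeightedL2.incl hW f t = S.state (sqrtRep (h - z • f)) y t := by
  rw [mem_graph_minimalOp, mem_graph_maximalOp_iff hι hJ₁ hJ S] at hf
  obtain ⟨⟨y, hy, h1⟩, u, hu, hc⟩ := hf
  refine ⟨y, hy, ?_, h1⟩
  have h2 : y = fun t => (J₁⁻¹ * ιᴴ) *ᵥ u t := by
    refine (Continuous.ae_eq_iff_eq volume hy.1 (hu.1.mulVec _).continuous).1 ?_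
    filter_upwards [h1, hu.2] with t h3 h4
    rw [h4, hJ, Matrix.mulVec_mulVec, Matrix.mul_assoc, Matrix.mul_assoc ι,
      ← Matrix.mul_assoc ιᴴ, hι, Matrix.one_mul, Matrix.nonsing_inv_mul_cancel_left _ _ hJ₁,
      h3, S.conjTranspose_mulVec_state]
  rw [h2]
  exact hc.comp_left (g := fun x => (J₁⁻¹ * ιᴴ) *ᵥ x) (Matrix.mulVec_zero _)

lemma mem_graph_minimalOp_of_isSolution (hι : ιᴴ * ι = 1) (hJ₁ : IsUnit J₁.det)
    (hJ : J = ι * J₁ * ιᴴ) (S : ReducedSystem ι J₁ (fun t => H t - z • W t) W)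
    {f h : WeightedL2 hW} {y : ℝ → Fin m → ℂ} (hy : S.IsSolution (sqrtRep (h - z • f)) y)
    (hc : HasCompactSupport y)
    (h1 : ∀ᵐ t, WeightedL2.incl hW f t = S.state (sqrtRep (h - z • f)) y t) :
    (f, h) ∈ (minimalOp J hH hW).graph := by
  refine mem_graph_minimalOp.2 ⟨(mem_graph_maximalOp_iff hι hJ₁ hJ S).2 ⟨y, hy, h1⟩,
    fun t => ι *ᵥ (J₁ *ᵥ y t), (isACRep_iff hι hJ₁ hJ).2
      ⟨y, hy.isLocAC (memLpLocVec_sqrtRep _), ?_, fun _ => rfl⟩, ?_⟩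
  · filter_upwards [h1] with t ht
    rw [ht, S.conjTranspose_mulVec_state]
  · exact hc.comp_left (g := fun x => ι *ᵥ (J₁ *ᵥ x)) (by simp)

end Graphs

/-! ### The adjoint of the minimal operator -/

section Adjoint

open Set

section Truncation

variable {n : ℕ} {W : ℝ → Matrix (Fin n) (Fin n) ℂ} {hW : IsWeight W} {a b : ℝ}

lemma exists_truncation (hW : IsWeight W) {κ : ℝ → Fin n → ℂ} (hκ : MemLpLocVec 2 κ) (a b : ℝ) :
    ∃ p : WeightedL2 hW, ∀ᵐ t, sqrtRep p t = (Icc a b).indicator κ t := by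
  refine exists_sqrtRep_eq hW fun i => ?_
  have h := (memLp_indicator_iff_restrict measurableSet_Icc).2 (hκ i () a b)
  refine h.congr_norm ?_ (Filter.Eventually.of_forall fun t => ?_)
  · have h1 := h.aestronglyMeasurable
    refine h1.congr (Filter.Eventually.of_forall fun t => ?_)
    by_cases ht : t ∈ Icc a b <;> simp [ht]
  · by_cases ht : t ∈ Icc a b <;> simp [ht]

lemma integral_eq_intervalIntegral_of_indicator {E : Type*} [NormedAddCommGroup E]
    [NormedSpace ℝ E] (hab : a ≤ b) {φ ψ : ℝ → E} (h : ∀ᵐ t, φ t = (Icc a b).indicator ψ t) :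
    ∫ t, φ t = ∫ t in a..b, ψ t := by
  rw [integral_congr_ae h, integral_indicator measurableSet_Icc, integral_Icc_eq_integral_Ioc,
    intervalIntegral.integral_of_le hab]

lemma inner_truncation_right (hab : a ≤ b) {p : WeightedL2 hW} {κ : ℝ → Fin n → ℂ}
    (hp : ∀ᵐ t, sqrtRep p t = (Icc a b).indicator κ t) (f : WeightedL2 hW) :
    inner ℂ f p = ∫ t in a..b, star (sqrtRep f t) ⬝ᵥ κ t := by
  rw [inner_eq_integral_sqrtRep]
  refine integral_eq_intervalIntegral_of_indicator hab (hp.mono fun t h => ?_)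
  rw [h]
  by_cases ht : t ∈ Icc a b <;> simp [ht]

lemma inner_truncation_left (hab : a ≤ b) {p : WeightedL2 hW} {κ : ℝ → Fin n → ℂ}
    (hp : ∀ᵐ t, sqrtRep p t = (Icc a b).indicator κ t) (f : WeightedL2 hW) :
    inner ℂ p f = ∫ t in a..b, star (κ t) ⬝ᵥ sqrtRep f t := by
  rw [inner_eq_integral_sqrtRep]
  refine integral_eq_intervalIntegral_of_indicator hab (hp.mono fun t h => ?_)
  rw [h]
  by_cases ht : t ∈ Icc a b <;> simp [ht]

end Truncation

variable {n m : ℕ} {J : Matrix (Fin n) (Fin n) ℂ} {H W : ℝ → Matrix (Fin n) (Fin n) ℂ}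
  {hH : MeasMat H} {hW : IsWeight W} {ι : Matrix (Fin n) (Fin m) ℂ}
  {J₁ : Matrix (Fin m) (Fin m) ℂ} {z : ℂ}

lemma ae_eq_conjTranspose (hHh : ∀ᵐ t, (H t).IsHermitian) (hW : IsWeight W) (z : ℂ) :
    ∀ᵐ t, H t - star z • W t = (H t - z • W t)ᴴ := by
  filter_upwards [hHh, hW.posSemidef] with t h1 h2
  rw [Matrix.conjTranspose_sub, Matrix.conjTranspose_smul, h1.eq, h2.1.eq]

lemma inner_eq_inner_of_mem_graph (hι : ιᴴ * ι = 1) (hJ₁ : IsUnit J₁.det) (hJ : J = ι * J₁ * ιᴴ)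
    (hJs : J₁ᴴ = -J₁) (hHh : ∀ᵐ t, (H t).IsHermitian)
    (S : ReducedSystem ι J₁ (fun t => H t - z • W t) W)
    (S' : ReducedSystem ι J₁ (fun t => H t - star z • W t) W) {f h g k : WeightedL2 hW}
    (hf : (f, h) ∈ (minimalOp J hH hW).graph) (hg : (g, k) ∈ (maximalOp J hH hW).graph) :
    inner ℂ h g = inner ℂ f k := by
  obtain ⟨y, hy, hc, h1⟩ := exists_isSolution_of_mem_graph_minimalOp hι hJ₁ hJ S hf
  obtain ⟨y', hy', h2⟩ := (mem_graph_maximalOp_iff hι hJ₁ hJ S').1 hg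
  have hi1 := integrable_dotProduct (memLp_sqrtRep (h - z • f)) (memLp_sqrtRep g)
  have hi2 := integrable_dotProduct (memLp_sqrtRep f) (memLp_sqrtRep (k - star z • g))
  have hlim := intervalIntegral_tendsto_integral (hi1.sub hi2) Filter.tendsto_neg_atTop_atBot
    Filter.tendsto_id
  have h0 : ∫ t, (star (sqrtRep (h - z • f) t) ⬝ᵥ sqrtRep g t -
      star (sqrtRep f t) ⬝ᵥ sqrtRep (k - star z • g) t) = 0 := by
    refine tendsto_nhds_unique hlim (tendsto_const_nhds.congr' ?_)
    have hev := hasCompactSupport_iff_eventuallyEq.1 hc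
    rw [Filter.coclosedCompact_eq_cocompact] at hev
    filter_upwards [hev.filter_mono atTop_le_cocompact, Filter.tendsto_neg_atTop_atBot.eventually
      (hev.filter_mono atBot_le_cocompact)] with N hN1 hN2
    have hl := ReducedSystem.integral_lagrange hJs (ae_eq_conjTranspose hHh hW z)
      (memLpLocVec_sqrtRep _) (memLpLocVec_sqrtRep _) hy hy' (-N) N
    rw [hN1, hN2] at hl
    simp only [Pi.zero_apply, star_zero, zero_dotProduct, sub_zero] at hl
    rw [← hl]
    refine intervalIntegral.integral_congr_ae ?_
    filter_upwards [h1, h2] with t e1 e2 _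
    simp only [Pi.sub_apply, sqrtRep] at e1 e2 ⊢
    rw [← e1, ← e2]
  rw [integral_sub hi1 hi2, ← inner_eq_integral_sqrtRep, ← inner_eq_integral_sqrtRep,
    inner_sub_left, inner_sub_right, inner_smul_left, inner_smul_right] at h0
  rw [starRingEnd_apply] at h0
  linear_combination h0

/-- Variation of constants on a compact interval: a right-hand side `q` supported in `[a, b]` and
orthogonal to the solutions of the adjoint homogeneous equation is `(L - z) f` for some `f` in the
domain of the minimal operator. -/
lemma exists_mem_graph_minimalOp (hι : ιᴴ * ι = 1) (hJ₁ : IsUnit J₁.det) (hJ : J = ι * J₁ * ιᴴ)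
    (hJs : J₁ᴴ = -J₁) (hHh : ∀ᵐ t, (H t).IsHermitian)
    (S : ReducedSystem ι J₁ (fun t => H t - z • W t) W)
    (S' : ReducedSystem ι J₁ (fun t => H t - star z • W t) W) {a b : ℝ} (hab : a ≤ b)
    {q : WeightedL2 hW} (hq : ∀ᵐ t, t ∉ Icc a b → sqrtRep q t = 0)
    (horth : ∀ v, S'.IsSolution 0 v →
      ∫ t in a..b, star (sqrtRep q t) ⬝ᵥ (CFC.sqrt (W t) *ᵥ S'.state 0 v t) = 0) :
    ∃ f : WeightedL2 hW, (f, z • f + q) ∈ (minimalOp J hH hW).graph ∧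
      ∀ (k : WeightedL2 hW) (y' : ℝ → Fin m → ℂ), S'.IsSolution (sqrtRep k) y' →
        inner ℂ f k = ∫ t in a..b,
          star (sqrtRep q t) ⬝ᵥ (CFC.sqrt (W t) *ᵥ S'.state (sqrtRep k) y' t) := by
  have hκ := memLpLocVec_sqrtRep q
  have hadj := ae_eq_conjTranspose hHh hW z
  obtain ⟨y, hy, hya⟩ := S.exists_isSolution hκ a 0
  have hx := S.memLpLocVec_sqrt_mulVec_state hκ hy.1
  have hyb : y b = 0 := by
    obtain ⟨v, hv, hvb⟩ := S'.exists_isSolution (κ := 0) memLpLocVec_zero b (J₁⁻¹ *ᵥ y b)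
    have hl := ReducedSystem.integral_lagrange hJs hadj hκ memLpLocVec_zero hy hv a b
    simp only [dotProduct_zero, sub_zero] at hl
    rw [show (fun _ => (0 : Fin n → ℂ)) = (0 : ℝ → Fin n → ℂ) from rfl, horth v hv, hya, hvb,
      Matrix.mulVec_mulVec, Matrix.mul_nonsing_inv _ hJ₁, Matrix.one_mulVec, star_zero,
      zero_dotProduct, zero_sub, eq_comm, neg_eq_zero] at hl
    exact dotProduct_star_self_eq_zero.1 hl
  have hy0 : ∀ t, t ∉ Icc a b → y t = 0 := by
    intro t ht
    rcases lt_or_ge t a with hta | hta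
    · refine hy.eq_zero hκ hya (b := t) ?_
      filter_upwards [hq, Measure.ae_ne volume a] with s h1 h2 h3
      rw [uIcc_of_ge hta.le] at h3
      exact h1 fun h4 => h2 (le_antisymm h3.2 h4.1)
    · have hbt : b < t := not_le.1 fun h => ht ⟨hta, h⟩
      refine hy.eq_zero hκ hyb (b := t) ?_
      filter_upwards [hq, Measure.ae_ne volume b] with s h1 h2 h3
      rw [uIcc_of_le hbt.le] at h3
      exact h1 fun h4 => h2 (le_antisymm h4.2 h3.1)
  obtain ⟨f, hf⟩ := exists_truncation hW hx a b
  have hfx : ∀ᵐ t, WeightedL2.incl hW f t = S.state (sqrtRep q) y t := by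
    filter_upwards [hf, hq, sqrt_mulVec_injective hW] with t h1 h2 h3
    by_cases ht : t ∈ Icc a b
    · rw [indicator_of_mem ht] at h1
      exact h3 h1
    · rw [indicator_of_notMem ht] at h1
      have h4 : S.state (sqrtRep q) y t = 0 := by
        rw [ReducedSystem.state, hy0 t ht, h2 ht]; simp
      rw [h4]
      exact h3 (h1.trans (Matrix.mulVec_zero _).symm)
  refine ⟨f, mem_graph_minimalOp_of_isSolution hι hJ₁ hJ S (y := y) ?_ ?_ ?_, ?_⟩
  · rwa [add_sub_cancel_left]
  · exact HasCompactSupport.intro (isCompact_Icc (a := a) (b := b)) hy0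
  · rwa [add_sub_cancel_left]
  · intro k y' hy'
    have hκ' := memLpLocVec_sqrtRep k
    have hl := ReducedSystem.integral_lagrange hJs hadj hκ hκ' hy hy' a b
    rw [hya, hyb, star_zero, zero_dotProduct, zero_dotProduct, sub_zero,
      intervalIntegral.integral_sub
        (intervalIntegrable_of_locallyIntegrable
          (hκ.locallyIntegrable_dotProduct (S'.memLpLocVec_sqrt_mulVec_state hκ' hy'.1)) a b)
        (intervalIntegrable_of_locallyIntegrable
          (hx.locallyIntegrable_dotProduct hκ') a b), sub_eq_zero] at hl
    rw [hl, inner_truncation_left hab hf]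

/-- An element of the adjoint relation of the minimal operator solves the adjoint equation on
`[a, b]`: its difference from a particular solution is orthogonal to everything orthogonal to the
finite-dimensional space of homogeneous solutions, and hence lies in that space. -/
lemma exists_isSolution_on_Icc (hι : ιᴴ * ι = 1) (hJ₁ : IsUnit J₁.det) (hJ : J = ι * J₁ * ιᴴ)
    (hJs : J₁ᴴ = -J₁) (hHh : ∀ᵐ t, (H t).IsHermitian)
    (S : ReducedSystem ι J₁ (fun t => H t - z • W t) W)
    (S' : ReducedSystem ι J₁ (fun t => H t - star z • W t) W) {g k : WeightedL2 hW}
    (hadj : ∀ f h, (f, h) ∈ (minimalOp J hH hW).graph → inner ℂ h g = inner ℂ f k)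
    {a b : ℝ} (hab : a ≤ b) :
    ∃ y, S'.IsSolution (sqrtRep (k - star z • g)) y ∧ ∀ᵐ t, t ∈ Icc a b →
      WeightedL2.incl hW g t = S'.state (sqrtRep (k - star z • g)) y t := by
  set κ' := sqrtRep (k - star z • g) with hκ'def
  have hκ' : MemLpLocVec 2 κ' := memLpLocVec_sqrtRep _
  have hz0 : MemLpLocVec 2 (0 : ℝ → Fin n → ℂ) := memLpLocVec_zero
  obtain ⟨y₀, hy₀, -⟩ := S'.exists_isSolution hκ' 0 0
  obtain ⟨v, hv, hspan⟩ := S'.exists_fundamental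
  have hu := S'.memLpLocVec_sqrt_mulVec_state hκ' hy₀.1
  obtain ⟨ψ, hψ⟩ := exists_truncation hW ((memLpLocVec_sqrtRep g).sub hu) a b
  choose p hp using fun i =>
    exists_truncation hW (S'.memLpLocVec_sqrt_mulVec_state hz0 (hv i).1) a b
  -- sums of the truncated homogeneous solutions
  have hstate : ∀ (κ : ℝ → Fin n → ℂ) (y : ℝ → Fin m → ℂ) (c : Fin m → ℂ) (t : ℝ),
      S'.state κ (y + ∑ i, c i • v i) t = S'.state κ y t + ∑ i, c i • S'.state 0 (v i) t := by
    intro κ y c t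
    simp only [ReducedSystem.state, Pi.add_apply, Finset.sum_apply, Pi.smul_apply,
      Matrix.mulVec_add, Pi.zero_apply, Matrix.mulVec_zero, add_zero, Matrix.mulVec_sum,
      Matrix.mulVec_smul]
    abel
  have hpsum : ∀ c : Fin m → ℂ, ∀ᵐ t, sqrtRep (∑ i, c i • p i) t = (Icc a b).indicator
      (fun t => CFC.sqrt (W t) *ᵥ ∑ i, c i • S'.state 0 (v i) t) t := by
    intro c
    filter_upwards [sqrtRep_sum c p, ae_all_iff.2 hp] with t h1 h2
    rw [h1]
    by_cases ht : t ∈ Icc a b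
    · simp only [h2, indicator_of_mem ht, Matrix.mulVec_sum, Matrix.mulVec_smul]
    · simp only [h2, indicator_of_notMem ht, smul_zero, Finset.sum_const_zero]
  let M : Submodule ℂ (WeightedL2 hW) := Submodule.span ℂ (range p)
  have : FiniteDimensional ℂ M := FiniteDimensional.span_of_finite ℂ (finite_range p)
  set q := ψ - M.starProjection ψ with hqdef
  have hqM : q ∈ Mᗮ := M.sub_starProjection_mem_orthogonal ψ
  obtain ⟨c, hc⟩ := (Submodule.mem_span_range_iff_exists_fun ℂ).1
    (M.starProjection_apply_mem ψ)
  have hq : ∀ᵐ t, t ∉ Icc a b → sqrtRep q t = 0 := by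
    rw [hqdef, ← hc]
    filter_upwards [sqrtRep_sub ψ (∑ i, c i • p i), hψ, hpsum c] with t h1 h2 h3 ht
    rw [h1, h2, h3, indicator_of_notMem ht, indicator_of_notMem ht, sub_zero]
  have horth : ∀ w, S'.IsSolution 0 w →
      ∫ t in a..b, star (sqrtRep q t) ⬝ᵥ (CFC.sqrt (W t) *ᵥ S'.state 0 w t) = 0 := by
    intro w hw
    have h1 : (∑ i, w 0 i • p i) ∈ M := Submodule.sum_mem _ fun i _ =>
      Submodule.smul_mem _ _ (Submodule.subset_span (mem_range_self i))
    have h2 := Submodule.inner_left_of_mem_orthogonal h1 hqM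
    rw [inner_truncation_right hab (hpsum _)] at h2
    rw [← h2]
    refine intervalIntegral.integral_congr fun t _ => ?_
    have h3 := hstate 0 0 (w 0) t
    rw [zero_add, ← hspan w hw] at h3
    simp only [h3]
    congr 2
    simp [ReducedSystem.state]
  obtain ⟨f, hf, hfk⟩ := exists_mem_graph_minimalOp (hH := hH) hι hJ₁ hJ hJs hHh S S' hab hq horth
  -- pairing with `f` shows `⟨q, ψ⟩ = 0`
  have hqψ : inner ℂ q ψ = 0 := by
    have h1 := hadj f _ hf
    have h2 := hfk _ y₀ hy₀
    rw [inner_add_left, inner_smul_left, starRingEnd_apply] at h1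
    rw [inner_sub_right, inner_smul_right] at h2
    have h3 : inner ℂ q g = ∫ t in a..b, star (sqrtRep q t) ⬝ᵥ sqrtRep g t := by
      refine inner_truncation_left hab ?_ g
      filter_upwards [hq] with t ht
      by_cases h : t ∈ Icc a b
      · rw [indicator_of_mem h]
      · rw [indicator_of_notMem h, ht h]
    have h4 := inner_truncation_right hab hψ q
    simp only [dotProduct_sub] at h4
    rw [intervalIntegral.integral_sub
        (intervalIntegrable_of_locallyIntegrable ((memLpLocVec_sqrtRep
          q).locallyIntegrable_dotProduct (memLpLocVec_sqrtRep g)) a b)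
        (intervalIntegrable_of_locallyIntegrable
          ((memLpLocVec_sqrtRep q).locallyIntegrable_dotProduct hu) a b)] at h4
    rw [h4, ← h3, ← h2]
    linear_combination h1
  have hq0 : q = 0 := by
    rw [← inner_self_eq_zero (𝕜 := ℂ)]
    nth_rw 2 [hqdef]
    rw [inner_sub_right, hqψ, Submodule.inner_left_of_mem_orthogonal
      (M.starProjection_apply_mem ψ) hqM, sub_zero]
  have hψc : ψ = ∑ i, c i • p i := (sub_eq_zero.1 hq0).trans hc.symm
  refine ⟨y₀ + ∑ i, c i • v i, ?_, ?_⟩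
  · have h := hy₀.add hκ' hz0 (ReducedSystem.isSolution_sum hv c Finset.univ)
    rwa [add_zero] at h
  · have h1 := hpsum c
    rw [← hψc] at h1
    filter_upwards [h1, hψ, sqrt_mulVec_injective hW] with t h2 h3 h4 ht
    rw [h2, indicator_of_mem ht, indicator_of_mem ht, eq_sub_iff_add_eq, ← Matrix.mulVec_add]
      at h3
    rw [hstate, add_comm]
    exact (h4 h3).symm

/-- The maximal operator is the adjoint relation of the minimal operator. -/
lemma mem_graph_maximalOp_iff_inner (hι : ιᴴ * ι = 1) (hJ₁ : IsUnit J₁.det)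
    (hJ : J = ι * J₁ * ιᴴ) (hJs : J₁ᴴ = -J₁) (hHh : ∀ᵐ t, (H t).IsHermitian)
    (S : ReducedSystem ι J₁ (fun t => H t - z • W t) W)
    (S' : ReducedSystem ι J₁ (fun t => H t - star z • W t) W) {g k : WeightedL2 hW} :
    (g, k) ∈ (maximalOp J hH hW).graph ↔
      ∀ f h, (f, h) ∈ (minimalOp J hH hW).graph → inner ℂ h g = inner ℂ f k := by
  refine ⟨fun hg f h hf => inner_eq_inner_of_mem_graph hι hJ₁ hJ hJs hHh S S' hf hg,
    fun hadj => ?_⟩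
  have hκ' := memLpLocVec_sqrtRep (k - star z • g)
  choose y hy hyg using fun N : ℕ =>
    exists_isSolution_on_Icc hι hJ₁ hJ hJs hHh S S' hadj
      (a := -((N : ℝ) + 1)) (b := (N : ℝ) + 1) (by linarith [N.cast_nonneg (α := ℝ)])
  -- two of these solutions agree at some point of `[-1, 1]`, and hence everywhere
  have heq : ∀ N, y N = y 0 := by
    intro N
    have h1 : ∀ᵐ t, t ∈ Icc (-1 : ℝ) 1 → y N t = y 0 t := by
      filter_upwards [hyg N, hyg 0] with t h1 h2 ht
      have hN : (0 : ℝ) ≤ N := N.cast_nonneg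
      have e1 := h1 ⟨by linarith [ht.1], by linarith [ht.2]⟩
      have e2 := h2 ⟨by simpa using ht.1, by simpa using ht.2⟩
      rw [← S'.conjTranspose_mulVec_state (sqrtRep (k - star z • g)) (y N) t, ← e1, e2,
        S'.conjTranspose_mulVec_state]
    obtain ⟨t, ht⟩ : ∃ t, y N t = y 0 t := by
      by_contra hne
      push Not at hne
      have h2 : ∀ᵐ t, t ∉ Icc (-1 : ℝ) 1 := h1.mono fun t h ht => hne t (h ht)
      have h3 : volume (Icc (-1 : ℝ) 1) = 0 := measure_eq_zero_iff_ae_notMem.2 h2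
      rw [Real.volume_Icc] at h3
      norm_num at h3
    exact (hy N).eq_of_eq hκ' (hy 0) ht
  refine (mem_graph_maximalOp_iff hι hJ₁ hJ S').2 ⟨y 0, hy 0, ?_⟩
  filter_upwards [ae_all_iff.2 hyg] with t ht
  obtain ⟨N, hN⟩ := exists_nat_ge |t|
  have h := ht N ⟨by linarith [neg_abs_le t], by linarith [le_abs_self t]⟩
  rwa [heq N] at h

end Adjoint

/-! ### Finiteness of the eigenspaces -/

section Eigenspaces

open Set

variable {n m : ℕ} {J : Matrix (Fin n) (Fin n) ℂ} {H W : ℝ → Matrix (Fin n) (Fin n) ℂ}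
  {hH : MeasMat H} {hW : IsWeight W} {ι : Matrix (Fin n) (Fin m) ℂ}
  {J₁ : Matrix (Fin m) (Fin m) ℂ} {z : ℂ}

lemma mem_opEigenspace_iff_graph {E : Type*} [AddCommGroup E] [Module ℂ E] {T : E →ₗ.[ℂ] E}
    {f : E} : f ∈ opEigenspace T z ↔ (f, z • f) ∈ T.graph := by
  rw [LinearPMap.mem_graph_iff]
  constructor
  · rintro ⟨h, h'⟩
    exact ⟨⟨f, h⟩, rfl, h'⟩
  · rintro ⟨⟨f', h⟩, rfl, h'⟩
    exact ⟨h, h'⟩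

/-- The elements of the eigenspace are determined by solutions of the homogeneous reduced system,
which form a space of dimension at most `m`. -/
lemma finiteDimensional_opEigenspace (hι : ιᴴ * ι = 1) (hJ₁ : IsUnit J₁.det)
    (hJ : J = ι * J₁ * ιᴴ) (S : ReducedSystem ι J₁ (fun t => H t - z • W t) W) :
    FiniteDimensional ℂ (opEigenspace (maximalOp J hH hW) z) := by
  obtain ⟨v, hv, hspan⟩ := S.exists_fundamental
  have hmeas : ∀ i, AEStronglyMeasurable (S.state 0 (v i)) volume := by
    intro i
    refine aesm_pi_iff.2 fun j => ?_
    simp only [ReducedSystem.state, Pi.zero_apply, Matrix.mulVec_zero, add_zero, Matrix.mulVec,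
      dotProduct]
    exact Finset.aemeasurable_fun_sum _ fun l _ =>
      (S.measP j l).mul ((continuous_apply l).comp (hv i).1).aemeasurable
  let p : Fin m → MeasFun n := fun i => AEEqFun.mk _ (hmeas i)
  have hle : (opEigenspace (maximalOp J hH hW) z).map (WeightedL2.incl hW) ≤
      Submodule.span ℂ (range p) := by
    rintro _ ⟨f, hf, rfl⟩
    rw [SetLike.mem_coe, mem_opEigenspace_iff_graph, mem_graph_maximalOp_iff hι hJ₁ hJ S] at hf
    obtain ⟨y, hy, h1⟩ := hf
    have h0 : ∀ᵐ t, sqrtRep (z • f - z • f) t = (0 : ℝ → Fin n → ℂ) t := by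
      filter_upwards [sqrtRep_sub (z • f) (z • f)] with t ht
      rw [ht, sub_self, Pi.zero_apply]
    have hy0 := hy.congr h0
    refine (Submodule.mem_span_range_iff_exists_fun ℂ).2 ⟨y 0, AEEqFun.ext ?_⟩
    have hsum : ∀ s : Finset (Fin m), ∀ᵐ t, (∑ i ∈ s, y 0 i • p i : MeasFun n) t =
        ∑ i ∈ s, y 0 i • S.state 0 (v i) t := by
      intro s
      induction s using Finset.induction_on with
      | empty =>
        filter_upwards with t
        simp
      | insert i s hi ih =>
        simp only [Finset.sum_insert hi]
        filter_upwards [ih, AEEqFun.coeFn_add (y 0 i • p i) (∑ i ∈ s, y 0 i • p i),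
          AEEqFun.coeFn_smul (y 0 i) (p i), AEEqFun.coeFn_mk _ (hmeas i)] with t e1 e2 e3 e4
        rw [e2, Pi.add_apply, e3, Pi.smul_apply, e4, e1]
    filter_upwards [hsum Finset.univ, h1, h0] with t e1 e2 e3
    rw [e1, e2]
    have e4 := congrFun (hspan y hy0) t
    simp only [ReducedSystem.state, e3, Pi.zero_apply, Matrix.mulVec_zero, add_zero]
    rw [e4]
    simp [Finset.sum_apply, Matrix.mulVec_sum, Matrix.mulVec_smul]
  have : FiniteDimensional ℂ (Submodule.span ℂ (range p)) :=
    FiniteDimensional.span_of_finite ℂ (finite_range p)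
  have := Submodule.finiteDimensional_of_le hle
  exact Module.Finite.equiv (Submodule.equivMapOfInjective (WeightedL2.incl hW)
    WeightedL2.incl_injective (opEigenspace (maximalOp J hH hW) z)).symm

end Eigenspaces

/-! ### Translation by a period -/

section Translation

open Set

variable {n : ℕ} {J : Matrix (Fin n) (Fin n) ℂ} {H W : ℝ → Matrix (Fin n) (Fin n) ℂ}
  {hH : MeasMat H} {hW : IsWeight W} {d : ℝ}

lemma absolutelyContinuousOnInterval_comp_add {X : Type*} [PseudoMetricSpace X] {u : ℝ → X}
    {a b : ℝ} (h : AbsolutelyContinuousOnInterval u (a + d) (b + d)) :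
    AbsolutelyContinuousOnInterval (fun t => u (t + d)) a b := by
  rw [absolutelyContinuousOnInterval_iff] at h ⊢
  intro ε hε
  obtain ⟨δ, hδ, h⟩ := h ε hε
  refine ⟨δ, hδ, fun E hE hlt => ?_⟩
  refine h (E.1, fun i => ((E.2 i).1 + d, (E.2 i).2 + d)) ⟨fun i hi => ?_, ?_⟩ ?_
  · have hmem : ∀ x ∈ uIcc a b, x + d ∈ uIcc (a + d) (b + d) := fun x hx => by
      rw [← image_add_const_uIcc]; exact mem_image_of_mem _ hx
    exact ⟨hmem _ (hE.1 i hi).1, hmem _ (hE.1 i hi).2⟩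
  · intro i hi j hj hij
    have hd := hE.2 hi hj hij
    simp only [Function.onFun, Set.disjoint_left, mem_uIoc] at hd ⊢
    intro x hx hx'
    refine hd (a := x - d) ?_ ?_
    · rcases hx with hx | hx
      · exact Or.inl ⟨by linarith [hx.1], by linarith [hx.2]⟩
      · exact Or.inr ⟨by linarith [hx.1], by linarith [hx.2]⟩
    · rcases hx' with hx | hx
      · exact Or.inl ⟨by linarith [hx.1], by linarith [hx.2]⟩
      · exact Or.inr ⟨by linarith [hx.1], by linarith [hx.2]⟩
  · simpa using hlt

/-- Translation `f ↦ f(· + d)` of measurable functions. -/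
def translate (d : ℝ) (f : MeasFun n) : MeasFun n :=
  f.compMeasurePreserving (· + d) (measurePreserving_add_right volume d)

lemma coeFn_translate (d : ℝ) (f : MeasFun n) : ∀ᵐ t, translate d f t = f (t + d) :=
  AEEqFun.coeFn_compMeasurePreserving f (measurePreserving_add_right volume d)

lemma ae_add_right {p : ℝ → Prop} (h : ∀ᵐ t, p t) (d : ℝ) : ∀ᵐ t, p (t + d) :=
  (measurePreserving_add_right volume d).quasiMeasurePreserving.ae h

lemma translate_mem (hWd : Function.Periodic W d) {f : MeasFun n} (hf : f ∈ weightedL2 hW) :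
    translate d f ∈ weightedL2 hW := by
  have h : Integrable (fun t => star (W t *ᵥ f t) ⬝ᵥ f t) volume := hf
  have h' : Integrable (fun t => star (W t *ᵥ translate d f t) ⬝ᵥ translate d f t) volume := by
    refine (h.comp_add_right d).congr ?_
    filter_upwards [coeFn_translate d f] with t ht
    rw [ht, hWd t]
  exact h'

/-- Translation by a period of the weight, as an operator on `L²(ℝ; W)`. -/
def translateL2 (hW : IsWeight W) (hWd : Function.Periodic W d) :
    WeightedL2 hW →ₗ[ℂ] WeightedL2 hW where
  toFun f := WeightedL2.of (translate d (WeightedL2.incl hW f))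
    (translate_mem hWd (WeightedL2.incl_mem f))
  map_add' f g := by
    refine WeightedL2.incl_injective (AEEqFun.ext ?_)
    rw [WeightedL2.incl_of, map_add, map_add, WeightedL2.incl_of, WeightedL2.incl_of]
    filter_upwards [coeFn_translate d (WeightedL2.incl hW f + WeightedL2.incl hW g),
      coeFn_translate d (WeightedL2.incl hW f), coeFn_translate d (WeightedL2.incl hW g),
      AEEqFun.coeFn_add (translate d (WeightedL2.incl hW f)) (translate d (WeightedL2.incl hW g)),
      ae_add_right (AEEqFun.coeFn_add (WeightedL2.incl hW f) (WeightedL2.incl hW g)) d]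
      with t h1 h2 h3 h4 h5
    rw [h1, h5, h4, Pi.add_apply, Pi.add_apply, h2, h3]
  map_smul' c f := by
    refine WeightedL2.incl_injective (AEEqFun.ext ?_)
    rw [RingHom.id_apply, WeightedL2.incl_of, map_smul, map_smul, WeightedL2.incl_of]
    filter_upwards [coeFn_translate d (c • WeightedL2.incl hW f),
      coeFn_translate d (WeightedL2.incl hW f),
      AEEqFun.coeFn_smul c (translate d (WeightedL2.incl hW f)),
      ae_add_right (AEEqFun.coeFn_smul c (WeightedL2.incl hW f)) d] with t h1 h2 h3 h4
    rw [h1, h4, h3, Pi.smul_apply, Pi.smul_apply, h2]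

lemma coeFn_translateL2 (hWd : Function.Periodic W d) (f : WeightedL2 hW) :
    ∀ᵐ t, WeightedL2.incl hW (translateL2 hW hWd f) t = WeightedL2.incl hW f (t + d) :=
  coeFn_translate d (WeightedL2.incl hW f)

lemma translateL2_mem_graph (hHd : Function.Periodic H d) (hWd : Function.Periodic W d)
    {f h : WeightedL2 hW} (hf : (f, h) ∈ (maximalOp J hH hW).graph) :
    (translateL2 hW hWd f, translateL2 hW hWd h) ∈ (maximalOp J hH hW).graph := by
  obtain ⟨u, hu, h1⟩ := mem_graph_maximalOp.1 hf
  refine mem_graph_maximalOp.2 ⟨fun t => u (t + d), ⟨fun a b =>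
    absolutelyContinuousOnInterval_comp_add (hu.1 _ _), ?_⟩, ?_⟩
  · filter_upwards [ae_add_right hu.2 d, coeFn_translateL2 hWd f] with t h2 h3
    rw [h2, h3]
  · filter_upwards [ae_add_right h1 d, coeFn_translateL2 hWd f, coeFn_translateL2 hWd h]
      with t h2 h3 h4
    rw [deriv_comp_add_const, h3, h4, ← hHd t, ← hWd t, h2]

/-- A finite measure invariant under a nontrivial translation vanishes; this is the form in which
square integrability excludes Bloch solutions. -/
lemma measure_eq_zero_of_translation_invariant {ν : Measure ℝ} [IsFiniteMeasure ν] (hd : 0 < d)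
    (h : ∀ s, ν (Ioi (s + d)) = ν (Ioi s)) : ν = 0 := by
  have hiter : ∀ (k : ℕ) (s : ℝ), ν (Ioi (s + k * d)) = ν (Ioi s) := by
    intro k
    induction k with
    | zero => intro s; simp
    | succ k ih =>
      intro s
      rw [← ih s, ← h (s + k * d)]
      congr 2
      push_cast; ring
  have hzero : ∀ s, ν (Ioi s) = 0 := by
    intro s
    have hanti : Antitone fun k : ℕ => Ioi (s + k * d) := fun k l hkl => by
      refine Ioi_subset_Ioi ?_
      have : (k : ℝ) ≤ l := by exact_mod_cast hkl
      nlinarith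
    have hlim := tendsto_measure_iInter_atTop (μ := ν)
      (fun k : ℕ => (measurableSet_Ioi (a := s + k * d)).nullMeasurableSet) hanti
      ⟨0, measure_ne_top _ _⟩
    have hempty : ⋂ k : ℕ, Ioi (s + k * d) = ∅ := by
      refine eq_empty_of_forall_notMem fun x hx => ?_
      obtain ⟨k, hk⟩ := exists_nat_gt ((x - s) / d)
      rw [div_lt_iff₀ hd] at hk
      have := mem_iInter.1 hx k
      rw [mem_Ioi] at this
      linarith
    rw [hempty, measure_empty] at hlim
    exact tendsto_nhds_unique (tendsto_const_nhds.congr fun k => (hiter k s).symm) hlim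
  have hcover : (univ : Set ℝ) ⊆ ⋃ k : ℕ, Ioi (-(k : ℝ)) := fun x _ => by
    obtain ⟨k, hk⟩ := exists_nat_gt (-x)
    exact mem_iUnion.2 ⟨k, by rw [mem_Ioi]; linarith⟩
  refine Measure.measure_univ_eq_zero.1 (measure_mono_null hcover ?_)
  exact measure_iUnion_null fun k => hzero _

/-- Translation by a period has no eigenvectors in `L²(ℝ; W)`. -/
lemma eq_zero_of_translateL2_eq_smul (hd : 0 < d) (hWd : Function.Periodic W d)
    {f : WeightedL2 hW} {μ : ℂ} (hf : translateL2 hW hWd f = μ • f) : f = 0 := by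
  have hrep : ∀ᵐ t, sqrtRep f (t + d) = μ • sqrtRep f t := by
    filter_upwards [sqrtRep_smul μ f, coeFn_translateL2 hWd f] with t h1 h2
    rw [← h1, ← hf, sqrtRep, sqrtRep, h2, hWd t]
  have hmem : MemLp (sqrtRep f) 2 volume := memLp_pi_iff.2 (memLp_sqrtRep f)
  have hmeas : AEMeasurable (fun t => ‖sqrtRep f t‖ₑ ^ 2) volume :=
    hmem.aestronglyMeasurable.enorm.pow_const 2
  have hfin : ∫⁻ t, ‖sqrtRep f t‖ₑ ^ 2 ≠ ⊤ := by
    have h := hmem.eLpNorm_lt_top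
    rw [eLpNorm_lt_top_iff_lintegral_rpow_enorm_lt_top (by norm_num) (by norm_num)] at h
    simpa using h.ne
  -- `ν` is `|W^{1/2} f|² dt`, which translation multiplies by `|μ|²`
  set ν : Measure ℝ := volume.withDensity fun t => ‖sqrtRep f t‖ₑ ^ 2 with hν
  have hνfin : IsFiniteMeasure ν := isFiniteMeasure_withDensity hfin
  have hscale : ∀ s : Set ℝ, MeasurableSet s →
      ν s = ‖μ‖ₑ ^ 2 * ν ((· + d) ⁻¹' s) := by
    intro s hs
    have hs' : MeasurableSet ((· + d) ⁻¹' s) := (measurable_add_const d) hs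
    rw [hν, withDensity_apply _ hs, withDensity_apply _ hs',
      ← (measurePreserving_add_right volume d).setLIntegral_comp_preimage_emb
        (measurableEmbedding_addRight d), ← lintegral_const_mul'' _ hmeas.restrict]
    refine lintegral_congr_ae (ae_restrict_of_ae (hrep.mono fun t ht => ?_))
    simp only [ht, enorm_smul, mul_pow]
  have hν0 : ν = 0 := by
    by_contra hne
    have h1 := hscale univ MeasurableSet.univ
    rw [preimage_univ] at h1
    have h2 : ν univ ≠ 0 := fun h => hne (Measure.measure_univ_eq_zero.1 h)
    have h3 : ‖μ‖ₑ ^ 2 = 1 := by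
      have h4 : ‖μ‖ₑ ^ 2 * ν univ = 1 * ν univ := by rw [one_mul, ← h1]
      exact (ENNReal.mul_left_inj h2 (measure_ne_top ν univ)).1 h4
    refine hne (measure_eq_zero_of_translation_invariant hd fun s => ?_)
    rw [hscale _ measurableSet_Ioi, h3, one_mul]
    congr 1
    ext x
    simp
  rw [hν, withDensity_eq_zero_iff hmeas] at hν0
  refine eq_of_sqrtRep_eq ?_
  filter_upwards [hν0, sqrtRep_smul (0 : ℂ) (0 : WeightedL2 hW)] with t h1 h2
  rw [zero_smul, zero_smul] at h2
  rw [h2]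
  simpa using h1

/-- A finite-dimensional eigenspace is invariant under translation by the period, so that it would
contain an eigenvector of the translation. -/
lemma opEigenspace_eq_bot (hd : 0 < d) (hHd : Function.Periodic H d)
    (hWd : Function.Periodic W d) (z : ℂ)
    (hfin : FiniteDimensional ℂ (opEigenspace (maximalOp J hH hW) z)) :
    opEigenspace (maximalOp J hH hW) z = ⊥ := by
  by_contra hne
  have := Submodule.nontrivial_iff_ne_bot.2 hne
  have hinv : ∀ f ∈ opEigenspace (maximalOp J hH hW) z,
      translateL2 hW hWd f ∈ opEigenspace (maximalOp J hH hW) z := by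
    intro f hf
    rw [mem_opEigenspace_iff_graph] at hf ⊢
    rw [← map_smul]
    exact translateL2_mem_graph hHd hWd hf
  obtain ⟨μ, hμ⟩ := Module.End.exists_eigenvalue ((translateL2 hW hWd).restrict hinv)
  obtain ⟨f, hf⟩ := hμ.exists_hasEigenvector
  have h1 := congrArg Subtype.val hf.apply_eq_smul
  exact hf.2 (Subtype.ext (eq_zero_of_translateL2_eq_smul hd hWd h1))

end Translation

/-! ### A criterion for essential self-adjointness -/

section SelfAdjoint

variable {E : Type*} [NormedAddCommGroup E] [InnerProductSpace ℂ E]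

/-- A relation between pairs in the graph of `T` which is expressed by inner products persists on
the closure of the graph. -/
lemma inner_eq_of_mem_topologicalClosure {G : Submodule ℂ (E × E)} {g k : E}
    (h : ∀ a b, (a, b) ∈ G → inner ℂ b g = inner ℂ a k) {a b : E}
    (hab : (a, b) ∈ G.topologicalClosure) : inner ℂ b g = inner ℂ a k := by
  have hcl : IsClosed {x : E × E | inner ℂ x.2 g = inner ℂ x.1 k} :=
    isClosed_eq (by fun_prop) (by fun_prop)
  exact closure_minimal (fun x hx => h x.1 x.2 hx) hcl hab

lemma abs_im_mul_norm_le {a b : E} (h : inner ℂ b a = (inner ℂ a b : ℂ)) (z : ℂ) :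
    |z.im| * ‖a‖ ≤ ‖b - z • a‖ := by
  have him : (inner ℂ a b : ℂ).im = 0 := by
    rw [← inner_conj_symm] at h
    have := congrArg Complex.im h
    rw [Complex.conj_im] at this
    linarith
  have h1 : (inner ℂ a (b - z • a) : ℂ).im = -(z.im * ‖a‖ ^ 2) := by
    rw [inner_sub_right, inner_smul_right, inner_self_eq_norm_sq_to_K, Complex.sub_im, him]
    simp [← Complex.ofReal_pow]
  have h2 : |z.im| * ‖a‖ ^ 2 ≤ ‖a‖ * ‖b - z • a‖ := by
    calc |z.im| * ‖a‖ ^ 2 = |(inner ℂ a (b - z • a) : ℂ).im| := by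
          rw [h1, abs_neg, abs_mul, abs_of_nonneg (sq_nonneg ‖a‖)]
      _ ≤ ‖(inner ℂ a (b - z • a) : ℂ)‖ := Complex.abs_im_le_norm _
      _ ≤ _ := norm_inner_le_norm _ _
  rcases (norm_nonneg a).eq_or_lt with ha | ha
  · rw [← ha, mul_zero]; exact norm_nonneg _
  · refine le_of_mul_le_mul_left ?_ ha
    linarith

variable [CompleteSpace E] {T L : E →ₗ.[ℂ] E} {z : ℂ}

lemma dense_domain_of_graph_eq_adjoint (h : L.graph = T.graph.adjoint) :
    Dense (T.domain : Set E) := by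
  rw [Submodule.dense_iff_topologicalClosure_eq_top, Submodule.topologicalClosure_eq_top_iff,
    Submodule.eq_bot_iff]
  intro g hg
  have h0 : ((0 : E), g) ∈ L.graph := by
    rw [h, Submodule.mem_adjoint_iff]
    intro a b hab
    obtain ⟨⟨a', ha'⟩, rfl, -⟩ := (LinearPMap.mem_graph_iff T).1 hab
    rw [inner_zero_right, zero_sub, neg_eq_zero]
    exact (Submodule.mem_orthogonal _ _).1 hg _ ha'
  exact L.graph_fst_eq_zero_snd h0 rfl

lemma adjoint_eq_of_graph_eq_adjoint (h : L.graph = T.graph.adjoint) : T† = L :=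
  LinearPMap.eq_of_eq_graph <| by
    rw [LinearPMap.adjoint_graph_eq_graph_adjoint (dense_domain_of_graph_eq_adjoint h), h]

/-- If the adjoint `L` of the symmetric operator `T` has no eigenvalues `z`, `z̄`, then the closure
of the graph of `T` is that of `L`: the range of `T̄ - z` is closed and dense, and `L - z` is
injective. -/
lemma topologicalClosure_graph_eq (h : L.graph = T.graph.adjoint) (hTL : T ≤ L) (hz : z.im ≠ 0)
    (h1 : opEigenspace L z = ⊥) (h2 : opEigenspace L (star z) = ⊥) :
    T.graph.topologicalClosure = L.graph := by
  have hdense := dense_domain_of_graph_eq_adjoint h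
  have hmem : ∀ {g k : E}, (g, k) ∈ L.graph ↔
      ∀ a b, (a, b) ∈ T.graph → inner ℂ b g = inner ℂ a k := fun {g k} => by
    rw [h, Submodule.mem_adjoint_iff]
    simp only [sub_eq_zero]
  have hclosed : IsClosed (L.graph : Set (E × E)) := by
    have := LinearPMap.adjoint_isClosed hdense
    rwa [adjoint_eq_of_graph_eq_adjoint h] at this
  have hGL : T.graph.topologicalClosure ≤ L.graph :=
    Submodule.topologicalClosure_minimal _ (LinearPMap.le_graph_of_le hTL) hclosed
  refine le_antisymm hGL ?_
  let G := T.graph.topologicalClosure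
  have hsymm : ∀ x ∈ G, inner ℂ x.2 x.1 = (inner ℂ x.1 x.2 : ℂ) := by
    intro x hx
    have hcl : IsClosed {x : E × E | inner ℂ x.2 x.1 = (inner ℂ x.1 x.2 : ℂ)} :=
      isClosed_eq (by fun_prop) (by fun_prop)
    exact closure_minimal (fun y hy => hmem.1 (LinearPMap.le_graph_of_le hTL hy) y.1 y.2 hy) hcl hx
  let φ : G →L[ℂ] E :=
    (ContinuousLinearMap.snd ℂ E E - z • ContinuousLinearMap.fst ℂ E E).comp G.subtypeL
  have hφ : ∀ x : G, φ x = x.1.2 - z • x.1.1 := fun x => rfl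
  have him : 0 < |z.im| := abs_pos.2 hz
  have hC : 1 ≤ |z.im|⁻¹ + 1 + ‖z‖ * |z.im|⁻¹ := by
    have := inv_pos.2 him
    nlinarith [norm_nonneg z, mul_nonneg (norm_nonneg z) this.le]
  have hbound : ∀ x : G, ‖x‖ ≤ (Real.toNNReal (|z.im|⁻¹ + 1 + ‖z‖ * |z.im|⁻¹)) * ‖φ x‖ := by
    intro x
    rw [Real.coe_toNNReal _ (zero_le_one.trans hC)]
    have e1 : ‖x.1.1‖ ≤ |z.im|⁻¹ * ‖φ x‖ := by
      rw [le_inv_mul_iff₀ him]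
      exact abs_im_mul_norm_le (hsymm x.1 x.2) z
    have e2 : ‖x.1.2‖ ≤ ‖φ x‖ + ‖z‖ * ‖x.1.1‖ := by
      calc ‖x.1.2‖ = ‖φ x + z • x.1.1‖ := by rw [hφ, sub_add_cancel]
        _ ≤ ‖φ x‖ + ‖z • x.1.1‖ := norm_add_le _ _
        _ = _ := by rw [norm_smul]
    have e3 : ‖z‖ * ‖x.1.1‖ ≤ ‖z‖ * (|z.im|⁻¹ * ‖φ x‖) :=
      mul_le_mul_of_nonneg_left e1 (norm_nonneg z)
    have e4 : 0 ≤ |z.im|⁻¹ * ‖φ x‖ := (norm_nonneg _).trans e1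
    have e5 : 0 ≤ ‖z‖ * (|z.im|⁻¹ * ‖φ x‖) := mul_nonneg (norm_nonneg z) e4
    have e6 := norm_nonneg (φ x)
    change ‖x.1‖ ≤ _
    rw [Prod.norm_def]
    refine max_le ?_ ?_ <;> linarith
  have hcomplete : CompleteSpace G := (Submodule.isClosed_topologicalClosure _).completeSpace_coe
  have hrange : IsClosed (Set.range φ) :=
    (AddMonoidHomClass.antilipschitz_of_bound φ hbound).isClosed_range φ.uniformContinuous
  have hsurj : LinearMap.range φ.toLinearMap = ⊤ := by
    have hcl : (LinearMap.range φ.toLinearMap).topologicalClosure =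
        LinearMap.range φ.toLinearMap := IsClosed.submodule_topologicalClosure_eq hrange
    rw [← hcl, Submodule.topologicalClosure_eq_top_iff, Submodule.eq_bot_iff]
    intro g hg
    have hg' : g ∈ opEigenspace L (star z) := by
      rw [mem_opEigenspace_iff_graph, hmem]
      intro a b hab
      have h3 := (Submodule.mem_orthogonal _ _).1 hg (b - z • a)
        ⟨⟨(a, b), T.graph.le_topologicalClosure hab⟩, rfl⟩
      rw [inner_sub_left, inner_smul_left, sub_eq_zero] at h3
      rw [h3, inner_smul_right]
      rfl
    rwa [h2, Submodule.mem_bot] at hg'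
  rintro ⟨g, k⟩ hgk
  obtain ⟨⟨⟨a, b⟩, hab⟩, hx⟩ := LinearMap.range_eq_top.1 hsurj (k - z • g)
  have h3 : b - z • a = k - z • g := hx
  have h4 : g - a ∈ opEigenspace L z := by
    rw [mem_opEigenspace_iff_graph]
    have h5 := L.graph.sub_mem hgk (hGL hab)
    have h6 : k - b = z • (g - a) := by
      rw [smul_sub, sub_eq_sub_iff_add_eq_add, add_comm, ← sub_eq_sub_iff_add_eq_add]
      rw [sub_eq_sub_iff_add_eq_add] at h3 ⊢
      rw [← sub_eq_zero] at h3 ⊢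
      rw [← neg_eq_zero, ← h3]
      abel
    rwa [Prod.mk_sub_mk, h6] at h5
  rw [h1, Submodule.mem_bot, sub_eq_zero] at h4
  subst h4
  have h7 : b = k := sub_left_injective h3
  rw [← h7]
  exact hab

lemma isSelfAdjoint_of_topologicalClosure_graph_eq (h : L.graph = T.graph.adjoint)
    (hTL : T ≤ L) (hcl : T.graph.topologicalClosure = L.graph) : IsSelfAdjoint L := by
  have hdense := dense_domain_of_graph_eq_adjoint h
  have hdL : Dense (L.domain : Set E) := hdense.mono hTL.1
  rw [LinearPMap.isSelfAdjoint_def]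
  refine LinearPMap.eq_of_eq_graph ?_
  rw [LinearPMap.adjoint_graph_eq_graph_adjoint hdL]
  ext ⟨g, k⟩
  constructor
  · intro hg
    rw [h]
    rw [Submodule.mem_adjoint_iff] at hg ⊢
    exact fun a b hab => hg a b (LinearPMap.le_graph_of_le hTL hab)
  · intro hg
    rw [h] at hg
    rw [Submodule.mem_adjoint_iff] at hg ⊢
    intro a b hab
    rw [← hcl] at hab
    exact sub_eq_zero.2 (inner_eq_of_mem_topologicalClosure
      (fun a b hab => sub_eq_zero.1 (hg a b hab)) hab)

end SelfAdjoint

/-! ### Periodic differential-algebraic operators -/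

lemma ae_of_ae_restrict_of_periodic {α : Type*} {d : ℝ} (hd : 0 < d) {F : ℝ → α}
    (hF : Function.Periodic F d) {p : α → Prop}
    (h : ∀ᵐ t ∂(volume.restrict (Set.Ioo 0 d)), p (F t)) : ∀ᵐ t, p (F t) := by
  rw [Measure.restrict_congr_set Ioo_ae_eq_Ico, ae_restrict_iff' measurableSet_Ico] at h
  have h1 : ∀ᵐ t, ∀ k : ℤ, t + k * d ∈ Set.Ico 0 d → p (F (t + k * d)) :=
    ae_all_iff.2 fun k => ae_add_right h (k * d)
  filter_upwards [h1] with t ht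
  have h2 := ht (-⌊t / d⌋) ⟨?_, ?_⟩
  · rwa [hF.int_mul (-⌊t / d⌋) t] at h2
  · have := (le_div_iff₀ hd).1 (Int.floor_le (t / d))
    push_cast
    linarith
  · have := (div_lt_iff₀ hd).1 (Int.lt_floor_add_one (t / d))
    push_cast
    linarith

lemma IsSplit.conjTranspose_eq_neg {n m m₂ : ℕ} {J : Matrix (Fin n) (Fin n) ℂ}
    {ι : Matrix (Fin n) (Fin m) ℂ} {ι₂ : Matrix (Fin n) (Fin m₂) ℂ}
    {J₁ : Matrix (Fin m) (Fin m) ℂ} (hs : IsSplit ι ι₂) (hJ₁ : J = ι * J₁ * ιᴴ)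
    (hJ : Jᴴ = -J) : J₁ᴴ = -J₁ := by
  have h1 : J₁ = ιᴴ * J * ι := by
    rw [hJ₁, Matrix.mul_assoc, Matrix.mul_assoc, hs.h11, Matrix.mul_one, ← Matrix.mul_assoc,
      hs.h11, Matrix.one_mul]
  rw [h1, Matrix.conjTranspose_mul, Matrix.conjTranspose_mul, Matrix.conjTranspose_conjTranspose,
    hJ, Matrix.neg_mul, Matrix.mul_neg, Matrix.mul_assoc]


end DAE

end

theorem mainTheorem1 {n : ℕ} (J : Matrix (Fin n) (Fin n) ℂ) (hJ0 : J ≠ 0) (hJ : Jᴴ = -J)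
    (H W : ℝ → Matrix (Fin n) (Fin n) ℂ) (hH : DAE.MeasMat H) (hW : DAE.IsWeight W)
    (d : ℝ) (hd : 0 < d) (hHd : Function.Periodic H d) (hWd : Function.Periodic W d)
    (hHherm : ∀ᵐ t ∂(volume.restrict (Set.Ioo 0 d)), (H t).IsHermitian)
    (z₀ : ℂ) (hz₀ : z₀.im ≠ 0)
    (hindex : DAE.LocalIndexOne J (fun t => H t - z₀ • W t) W) :
    Dense ((DAE.minimalOp J hH hW).domain : Set (DAE.WeightedL2 hW)) ∧
    (DAE.minimalOp J hH hW)† = DAE.maximalOp J hH hW ∧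
    IsSelfAdjoint (DAE.maximalOp J hH hW) ∧
    ((DAE.minimalOp J hH hW).IsClosable ∧
      IsSelfAdjoint (DAE.minimalOp J hH hW).closure ∧
      (DAE.minimalOp J hH hW).closure = DAE.maximalOp J hH hW) ∧
    DAE.NoFiniteMultiplicityEigenvalue (DAE.maximalOp J hH hW) := by
  have hHh : ∀ᵐ t, (H t).IsHermitian :=
    DAE.ae_of_ae_restrict_of_periodic hd hHd (p := Matrix.IsHermitian) hHherm
  obtain ⟨m, m₂, V, hV, hblock⟩ := hindex.exists_blocks
  have hs := hV.isSplit
  obtain ⟨J₁, hJ₁, hJeq⟩ := hV.exists_eq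
  have hJs := hs.conjTranspose_eq_neg hJeq hJ
  have hK : ∀ z : ℂ, DAE.MeasMat fun t => H t - z • W t := fun z i j =>
    (hH i j).sub ((hW.meas i j).const_mul z)
  have hschur := hs.schurConditions hW hblock
  let S : DAE.ReducedSystem V.toCols₁ J₁ (fun t => H t - z₀ • W t) W :=
    hschur.reducedSystem hs hW (hK z₀) hJ₁
  let S' : DAE.ReducedSystem V.toCols₁ J₁ (fun t => H t - star z₀ • W t) W :=
    (hschur.adjoint (DAE.ae_eq_conjTranspose hHh hW z₀)).reducedSystem hs hW (hK _) hJ₁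
  have hgraph : (DAE.maximalOp J hH hW).graph = (DAE.minimalOp J hH hW).graph.adjoint := by
    ext ⟨g, k⟩
    rw [DAE.mem_graph_maximalOp_iff_inner hs.h11 hJ₁ hJeq hJs hHh S S', Submodule.mem_adjoint_iff]
    simp only [sub_eq_zero]
  have hle : DAE.minimalOp J hH hW ≤ DAE.maximalOp J hH hW := LinearPMap.domRestrict_le
  have hcl := DAE.topologicalClosure_graph_eq hgraph hle hz₀
    (DAE.opEigenspace_eq_bot hd hHd hWd _ (DAE.finiteDimensional_opEigenspace hs.h11 hJ₁ hJeq S))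
    (DAE.opEigenspace_eq_bot hd hHd hWd _ (DAE.finiteDimensional_opEigenspace hs.h11 hJ₁ hJeq S'))
  have hsa := DAE.isSelfAdjoint_of_topologicalClosure_graph_eq hgraph hle hcl
  have hclosable : (DAE.minimalOp J hH hW).IsClosable := ⟨_, hcl⟩
  have hclosure : (DAE.minimalOp J hH hW).closure = DAE.maximalOp J hH hW :=
    LinearPMap.eq_of_eq_graph (hclosable.graph_closure_eq_closure_graph.symm.trans hcl)
  exact ⟨DAE.dense_domain_of_graph_eq_adjoint hgraph, DAE.adjoint_eq_of_graph_eq_adjoint hgraph,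
    hsa, ⟨hclosable, hclosure ▸ hsa, hclosure⟩,
    fun z hne hfin => hne (DAE.opEigenspace_eq_bot hd hHd hWd z hfin)⟩
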